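/- All groups are finite, and a class of groups is closed under isomorphism. A formation is a non-empty class of groups closed under homomorphic images and subdirect products. It is subgroup-closed if it contains every subgroup of each of its members, and saturated if $G\in\mathfrak F$ whenever $G/\Phi(G)\in\mathfrak F$. For a formation $\mathfrak F$, the residual $G^{\mathfrak F}$ is the smallest normal subgroup $N$ of $G$ with $G/N\in\mathfrak F$, and for a class $\mathfrak X$ we let $\mathfrak X\circ\mathfrak F$ be the class of all groups $G$ with $G^{\mathfrak F}\in\mathfrak X$. Let $\pi$ be a set of primes and $\pi'$ its complement in the set of all primes. Write $\mathfrak N$, $\mathfrak S_\pi$ and $\mathfrak G_p$ for the classes of nilpotent groups, of $\pi$-solvable groups (every chief factor is a $\pi'$-group or a $p$-group with $p\in\pi$) and of $p$-groups. Let $O_{\pi'}(G)$ be the largest normal $\pi'$-subgroup of $G$. Put $$\mathcal N_{\pi'\mathfrak F}(G)=\bigcap_{H\le G}N_G\bigl(H^{\mathfrak F}O_{\pi'}(G)\bigr),$$ $\mathcal N^0_{\pi'\mathfrak F}(G)=1$ and $\mathcal N^{i}_{\pi'\mathfrak F}(G)/\mathcal N^{i-1}_{\pi'\mathfrak F}(G)=\mathcal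 N_{\pi'\mathfrak F}\bigl(G/\mathcal N^{i-1}_{\pi'\mathfrak F}(G)\bigr)$ for $i\ge1$, and let $\mathcal N^\infty_{\pi'\mathfrak F}(G)$ be the terminal term of this ascending series. For a class $\mathfrak X$, a chief factor $L/K$ of $G$ is $\mathfrak X$-central in $G$ if $(L/K)\rtimes(G/C_G(L/K))\in\mathfrak X$, where $G/C_G(L/K)$ acts by conjugation. The $\pi\mathfrak X$-hypercentre $Z_{\pi\mathfrak X}(G)$ is the product of all normal subgroups $N$ of $G$ such that every chief factor $L/K$ of $G$ with $L\le N$ and with order divisible by at least one prime in $\pi$ is $\mathfrak X$-central in $G$. A group is $\mathtt S$-critical for $\mathfrak X$ if it is not in $\mathfrak X$ but all its proper subgroups are. A formation $\mathfrak F$ satisfies the $\pi$-boundary condition (II) if for every $p\in\pi$ each $\mathtt S$-critical group for $\mathfrak G_p\circ\mathfrak F$ belongs to $\mathfrak S_\pi\circ\mathfrak F$. **Corollary 3.4.** Let $\mathfrak F$ be a subgroup-closed formation and $G$ a finite group. Suppose that $G\in\mathfrak S_\pi\circ\mathfrak F$ or that $\mathfrak F$ satisfies the $\pi$-boundary condition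 (II). Then $K:=Z_{\pi\mathfrak N}(G^{\mathfrak F})$ is a normal subgroup of $G$ contained in $\mathcal N^\infty_{\pi'\mathfrak F}(G)$ and in $Z_{\pi(\mathfrak N\circ\mathfrak F)}(G)$, and $$\mathcal N^\infty_{\pi'\mathfrak F}(G)/K=\mathcal N_{\pi'\mathfrak F}(G/K)=Z_{\pi(\mathfrak N\circ\mathfrak F)}(G)/K.$$ If, in addition, $\mathfrak F$ is saturated, then these subgroups of $G/K$ are also equal to $Z_{\pi\mathfrak F}(G/K)$. -/

import Mathlib

universe u

/-- A class of finite groups: a property of groups (in a fixed universe) which implies finiteness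
and is invariant under isomorphism. -/
structure GroupClass where
  /-- Membership in the class. -/
  Mem : (G : Type u) → [Group G] → Prop
  finite : ∀ {G : Type u} [Group G], Mem G → Finite G
  of_equiv : ∀ {G H : Type u} [Group G] [Group H], (G ≃* H) → Mem G → Mem H

namespace GroupClass

/-- A formation: a non-empty class of finite groups closed under homomorphic images and
subdirect products (if `G/M` and `G/N` belong to the class, then so does `G/(M ∩ N)`). -/
structure IsFormation (F : GroupClass.{u}) : Prop where
  nonempty : ∃ (G : Type u) (_ : Group G), F.Mem G
  of_surjective : ∀ {G H : Type u} [Group G] [Group H] (f : G →* H),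
    Function.Surjective f → F.Mem G → F.Mem H
  quotient_inf : ∀ {G : Type u} [Group G] (M N : Subgroup G) [M.Normal] [N.Normal],
    F.Mem (G ⧸ M) → F.Mem (G ⧸ N) → F.Mem (G ⧸ (M ⊓ N))

/-- `F = S F`: the class is closed under taking subgroups. -/
def IsSubgroupClosed (F : GroupClass.{u}) : Prop :=
  ∀ {G : Type u} [Group G] (H : Subgroup G), F.Mem G → F.Mem H

/-- A class is saturated if a finite group `G` lies in it whenever `G/Φ(G)` does. -/
def IsSaturated (F : GroupClass.{u}) : Prop :=
  ∀ {G : Type u} [Group G] [Finite G], F.Mem (G ⧸ frattini G) → F.Mem G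

/-! ### Residuals and radicals -/

/-- The `F`-residual of `G`: the intersection of all normal subgroups `N` with `G/N ∈ F`. When `F`
is a formation and `G` is finite, this is the smallest such `N`. -/
def residual (F : GroupClass.{u}) (G : Type u) [Group G] : Subgroup G :=
  sInf {N | ∃ _ : N.Normal, F.Mem (G ⧸ N)}

/-- The `X`-radical of `G`: the subgroup generated by all normal subgroups of `G` lying in `X`. When
`X` is a Fitting class and `G` is finite, this is the largest normal `X`-subgroup of `G`. -/
def radical (X : GroupClass.{u}) (G : Type u) [Group G] : Subgroup G :=
  sSup {N | N.Normal ∧ X.Mem N}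

theorem residual_le_comap (F : GroupClass.{u}) {G H : Type u} [Group G] [Group H] (e : G ≃* H) :
    F.residual G ≤ (F.residual H).comap (e : G →* H) := by
  intro x hx
  simp only [residual, Subgroup.mem_comap, Subgroup.mem_sInf] at hx ⊢
  rintro N ⟨hN, hFN⟩
  refine hx (N.comap (e : G →* H)) ⟨inferInstance, ?_⟩
  exact F.of_equiv (QuotientGroup.congr (N.comap (e : G →* H)) N e
    (Subgroup.map_comap_eq_self_of_surjective (f := (e : G →* H)) e.surjective N)).symm hFN

theorem residual_map (F : GroupClass.{u}) {G H : Type u} [Group G] [Group H] (e : G ≃* H) :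
    (F.residual G).map (e : G →* H) = F.residual H := by
  apply le_antisymm
  · exact Subgroup.map_le_iff_le_comap.2 (F.residual_le_comap e)
  · intro y hy
    exact ⟨e.symm y, F.residual_le_comap e.symm hy, e.apply_symm_apply y⟩

theorem radical_map_le (X : GroupClass.{u}) {G H : Type u} [Group G] [Group H] (e : G ≃* H) :
    (X.radical G).map (e : G →* H) ≤ X.radical H := by
  rw [Subgroup.map_le_iff_le_comap]
  refine sSup_le ?_
  rintro N ⟨hN, hXN⟩
  rw [← Subgroup.map_le_iff_le_comap]
  exact le_sSup ⟨hN.map _ e.surjective, X.of_equiv (e.subgroupMap N) hXN⟩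

theorem radical_map (X : GroupClass.{u}) {G H : Type u} [Group G] [Group H] (e : G ≃* H) :
    (X.radical G).map (e : G →* H) = X.radical H := by
  refine le_antisymm (X.radical_map_le e) ?_
  intro y hy
  exact ⟨e.symm y, X.radical_map_le e.symm ⟨y, hy, rfl⟩, e.apply_symm_apply y⟩

/-- The formation product `X ∘ F`: the class of all finite groups `G` with `G^F ∈ X`. -/
def formationProduct (X F : GroupClass.{u}) : GroupClass.{u} where
  Mem G _ := Finite G ∧ X.Mem (F.residual G)
  finite h := h.1
  of_equiv {G H} _ _ e h := by
    refine ⟨@Finite.of_equiv H G h.1 e.toEquiv, ?_⟩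
    have h2 := X.of_equiv (e.subgroupMap (F.residual G)) h.2
    have h3 : (F.residual G).map (e : G →* H) = F.residual H := F.residual_map e
    rwa [h3] at h2

/-! ### Norms -/

/-- The `X`-`F`-norm of `G`: the intersection, over all subgroups `H` of `G`, of the normalizers of
the products `H^F G_X` (the radical `G_X` is normal, so that product is the join). -/
def norm (X F : GroupClass.{u}) (G : Type u) [Group G] : Subgroup G :=
  ⨅ H : Subgroup G, Subgroup.normalizer
    (((F.residual H).map H.subtype ⊔ X.radical G : Subgroup G) : Set G)

theorem norm_le_comap (X F : GroupClass.{u}) {G H : Type u} [Group G] [Group H] (e : G ≃* H) :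
    X.norm F G ≤ (X.norm F H).comap (e : G →* H) := by
  intro x hx
  simp only [norm, Subgroup.mem_comap, Subgroup.mem_iInf] at hx ⊢
  intro K
  obtain ⟨L, rfl⟩ : ∃ L : Subgroup G, L.map (e : G →* H) = K :=
    ⟨K.comap (e : G →* H), Subgroup.map_comap_eq_self_of_surjective (f := (e : G →* H)) e.surjective K⟩
  have h1 : ((F.residual L).map L.subtype ⊔ X.radical G).map (e : G →* H) =
      (F.residual (L.map (e : G →* H))).map (L.map (e : G →* H)).subtype ⊔ X.radical H := by
    have h2 : (F.residual L).map (e.subgroupMap L : L →* L.map (e : G →* H)) =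
        F.residual (L.map (e : G →* H)) := F.residual_map (e.subgroupMap L)
    rw [Subgroup.map_sup, X.radical_map e, ← h2, Subgroup.map_map, Subgroup.map_map]
    rfl
  rw [← h1]
  exact Subgroup.le_normalizer_map (e : G →* H) ⟨x, hx L, rfl⟩

instance norm_normal (X F : GroupClass.{u}) (G : Type u) [Group G] : (X.norm F G).Normal :=
  ⟨fun _ hn g => X.norm_le_comap F (MulAut.conj g) hn⟩

/-- The ascending series `N^0 = 1`, `N^(i+1)/N^i = N_{X,F}(G/N^i)`, together with normality of its
terms. -/
def normSeries (X F : GroupClass.{u}) (G : Type u) [Group G] : ℕ → {N : Subgroup G // N.Normal}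
  | 0 => ⟨⊥, inferInstance⟩
  | i + 1 =>
    let N := normSeries X F G i
    haveI := N.2
    ⟨(X.norm F (G ⧸ N.1)).comap (QuotientGroup.mk' N.1), inferInstance⟩

/-- The terminal term of the ascending series (its union, which for a finite group is the term at
which the series becomes stationary). -/
def normInfty (X F : GroupClass.{u}) (G : Type u) [Group G] : Subgroup G :=
  ⨆ i, (normSeries X F G i).1

end GroupClass

/-! ### Chief factors -/

/-- `L/K` is a chief factor of `G`. -/
structure IsChiefFactor {G : Type u} [Group G] (K L : Subgroup G) : Prop where
  normal_bot : K.Normal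
  normal_top : L.Normal
  lt : K < L
  eq_or_eq : ∀ M : Subgroup G, M.Normal → K ≤ M → M ≤ L → M = K ∨ M = L

/-- The subgroup `L/K` of `G/K`. -/
abbrev factor {G : Type u} [Group G] (K L : Subgroup G) [K.Normal] : Subgroup (G ⧸ K) :=
  L.map (QuotientGroup.mk' K)

/-- The action of `G` on `L/K` by conjugation; its kernel is the centralizer `C_G(L/K)`. -/
def factorAction {G : Type u} [Group G] (K L : Subgroup G) [K.Normal] [hL : L.Normal] :
    G →* MulAut (factor K L) :=
  haveI : (factor K L).Normal := hL.map _ (QuotientGroup.mk'_surjective K)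
  (MulAut.conjNormal (H := factor K L)).comp (QuotientGroup.mk' K)

namespace GroupClass

/-- `L/K` is `F`-central in `G`: the semidirect product `(L/K) ⋊ (G/C_G(L/K))` lies in `F`. -/
def IsCentralFactor (F : GroupClass.{u}) {G : Type u} [Group G] (K L : Subgroup G)
    [K.Normal] [L.Normal] : Prop :=
  F.Mem (SemidirectProduct (factor K L) (G ⧸ (factorAction K L).ker)
    (QuotientGroup.kerLift (factorAction K L)))

/-- `N` is `πF`-hypercentral in `G`: every chief factor `L/K` of `G` with `L ≤ N` and with order
divisible by some prime in `π` is `F`-central (which holds vacuously for `N = 1`). -/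
def IsHypercentral (π : Set Nat.Primes) (F : GroupClass.{u}) {G : Type u} [Group G]
    (N : Subgroup G) : Prop :=
  ∀ (K L : Subgroup G) (h : IsChiefFactor K L), L ≤ N →
    (∃ p ∈ π, (p : ℕ) ∣ K.relIndex L) →
    haveI := h.normal_bot
    haveI := h.normal_top
    F.IsCentralFactor K L

/-- The `πF`-hypercentre of `G`: the product of all `πF`-hypercentral normal subgroups. -/
def hypercentre (π : Set Nat.Primes) (F : GroupClass.{u}) (G : Type u) [Group G] : Subgroup G :=
  sSup {N | N.Normal ∧ IsHypercentral π F N}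

/-! ### Particular classes -/

/-- The class of finite `π`-groups. -/
def piGroups (π : Set Nat.Primes) : GroupClass.{u} where
  Mem G _ := Finite G ∧ ∀ p : Nat.Primes, (p : ℕ) ∣ Nat.card G → p ∈ π
  finite h := h.1
  of_equiv e h := ⟨@Finite.of_equiv _ _ h.1 e.toEquiv, Nat.card_congr e.toEquiv ▸ h.2⟩

/-- The class of finite nilpotent groups. -/
def nilpotentGroups : GroupClass.{u} where
  Mem G _ := Finite G ∧ Group.IsNilpotent G
  finite h := h.1
  of_equiv e h := ⟨@Finite.of_equiv _ _ h.1 e.toEquiv,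
    haveI := h.2
    Group.nilpotent_of_mulEquiv e⟩

end GroupClass

theorem IsChiefFactor.comap {G H : Type u} [Group G] [Group H] (e : G ≃* H) {K L : Subgroup H}
    (h : IsChiefFactor K L) :
    IsChiefFactor (K.comap (e : G →* H)) (L.comap (e : G →* H)) where
  normal_bot := h.normal_bot.comap _
  normal_top := h.normal_top.comap _
  lt := (Subgroup.comap_lt_comap_of_surjective e.surjective).2 h.lt
  eq_or_eq M hM h1 h2 := by
    have hK := Subgroup.map_comap_eq_self_of_surjective (f := (e : G →* H)) e.surjective K
    have hL := Subgroup.map_comap_eq_self_of_surjective (f := (e : G →* H)) e.surjective L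
    have hM' : (M.map (e : G →* H)).comap (e : G →* H) = M :=
      Subgroup.comap_map_eq_self_of_injective e.injective M
    rcases h.eq_or_eq (M.map (e : G →* H)) (hM.map _ e.surjective)
      (hK ▸ Subgroup.map_mono h1) (hL ▸ Subgroup.map_mono h2) with h3 | h3
    · exact Or.inl (h3 ▸ hM'.symm)
    · exact Or.inr (h3 ▸ hM'.symm)

namespace GroupClass

/-- The class of finite `π`-solvable groups: every chief factor is either a `π'`-group or a
`p`-group for some `p ∈ π`. -/
def piSolvableGroups (π : Set Nat.Primes) : GroupClass.{u} where
  Mem G _ := Finite G ∧ ∀ K L : Subgroup G, IsChiefFactor K L →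
    (∀ p ∈ π, ¬ (p : ℕ) ∣ K.relIndex L) ∨ ∃ p ∈ π, ∃ n : ℕ, K.relIndex L = (p : ℕ) ^ n
  finite h := h.1
  of_equiv {G H} _ _ e h := by
    refine ⟨@Finite.of_equiv _ _ h.1 e.toEquiv, fun K L hKL => ?_⟩
    have h1 := h.2 _ _ (hKL.comap e)
    rwa [Subgroup.relIndex_comap,
      Subgroup.map_comap_eq_self_of_surjective (f := (e : G →* H)) e.surjective L] at h1

/-- `G` is `S`-critical for `X`: it is a finite group outside `X` all of whose proper subgroups
belong to `X`. -/
def IsCritical (X : GroupClass.{u}) (G : Type u) [Group G] : Prop :=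
  Finite G ∧ ¬ X.Mem G ∧ ∀ H : Subgroup G, H ≠ ⊤ → X.Mem H

/-- The `π`-boundary condition (II): for every `p ∈ π`, each `S`-critical group for `G_p ∘ F`
belongs to `S_π ∘ F`. -/
def BoundaryConditionII (π : Set Nat.Primes) (F : GroupClass.{u}) : Prop :=
  ∀ p ∈ π, ∀ (G : Type u) [Group G],
    IsCritical (formationProduct (piGroups {p}) F) G →
      (formationProduct (piSolvableGroups π) F).Mem G

/-- The `πF`-norm of `G`. -/
abbrev piNorm (π : Set Nat.Primes) (F : GroupClass.{u}) (G : Type u) [Group G] : Subgroup G :=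
  norm (piGroups π) F G

/-- The terminal term of the ascending series of `πF`-norms of `G`. -/
abbrev piNormInfty (π : Set Nat.Primes) (F : GroupClass.{u}) (G : Type u) [Group G] :
    Subgroup G :=
  normInfty (piGroups π) F G

/-- `Z_{πN}(G^F)` regarded as a subgroup of `G`, where `N` is the class of nilpotent groups. -/
def residualHypercentre (π : Set Nat.Primes) (F : GroupClass.{u}) (G : Type u) [Group G] :
    Subgroup G :=
  (hypercentre π nilpotentGroups (F.residual G)).map (F.residual G).subtype

end GroupClass

/-! For a subgroup `R` of `G`, let `relHypercentre π R` be the largest normal subgroup of `G` whose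
chief factors of order divisible by a prime of `π` are centralised by `R`. With `R = G^F` and `Z`
this subgroup, every object in the statement reduces to `Z`.

Hypercentres: a chief factor `L/K` is `N∘F`-central exactly when `[L, R] ≤ K`
(`isCentralFactor_formationProduct_iff`), so `Z` is the `π(N∘F)`-hypercentre. Taking the formation
of trivial groups gives the nilpotent case inside `R`, and comparing chief factors of `R` and of `G`
gives `K = Z ∩ R` (`residualHypercentre_eq`).

Norm series: the crux is that the norm lies in `Z` (`piNorm_le_relHypercentre`). After factoring out
a `π'`-radical, this says that a minimal normal subgroup `L` with `p ∣ |L|`, `p ∈ π`, which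
normalises every `U^F`, is centralised by `G^F`. For a minimal `U` such that `T = O^p(U^F)` does not
centralise `L`, either alternative hypothesis supplies a proper normal subgroup of `T` above
`C_T(L)` of `p'`-index; then the `p`-elements of `T` lie in `Φ(U)`, and a Schur–Zassenhaus and
Frattini argument makes `T` a `p'`-group. Now `[L, T] ≤ L ∩ T = 1`, a contradiction. So `G^F` acts
on `L` as a `p`-group, has a nontrivial fixed point, and centralises `L` by minimality. Conversely,
a minimal normal subgroup inside `Z` is centralised by `G^F` or is a `π'`-group, and lies in the
norm in both cases. Hence the series ends exactly at `Z`.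

Modulo `K`, the image of `Z` meets the residual trivially. It therefore commutes with the residual,
so it lies in the norm, and its chief factors avoid the residual, which makes them `F`-central. -/

namespace GroupClass

/-! ### Residuals under homomorphisms and in subgroups -/

variable {F : GroupClass.{u}}

/-- The `F`-residual of a subgroup `H` of `G`, as a subgroup of `G`. -/
def residualIn (F : GroupClass.{u}) {G : Type u} [Group G] (H : Subgroup G) : Subgroup G :=
  (F.residual H).map H.subtype

instance residual_normal (F : GroupClass.{u}) (G : Type u) [Group G] : (F.residual G).Normal :=
  ⟨fun _ hn g => F.residual_le_comap (MulAut.conj g) hn⟩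

theorem IsFormation.mem_of_subsingleton (hF : F.IsFormation) {G : Type u} [Group G]
    [Subsingleton G] : F.Mem G := by
  obtain ⟨H, _, hH⟩ := hF.nonempty
  exact hF.of_surjective (1 : H →* G) (fun y => ⟨1, Subsingleton.elim _ _⟩) hH

theorem IsFormation.mem_quotient_residual (hF : F.IsFormation) (G : Type u) [Group G] [Finite G] :
    F.Mem (G ⧸ F.residual G) := by
  have hfin : {N : Subgroup G | ∃ _ : N.Normal, F.Mem (G ⧸ N)}.Finite := Set.toFinite _
  have hinf : InfClosed {N : Subgroup G | ∃ _ : N.Normal, F.Mem (G ⧸ N)} := by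
    rintro M ⟨hM, h1⟩ N ⟨hN, h2⟩
    exact ⟨inferInstance, hF.quotient_inf M N h1 h2⟩
  have htop : (⊤ : Subgroup G) ∈ {N : Subgroup G | ∃ _ : N.Normal, F.Mem (G ⧸ N)} :=
    ⟨inferInstance,
      have := QuotientGroup.subsingleton_quotient_top (G := G)
      hF.mem_of_subsingleton⟩
  obtain ⟨_, h⟩ := hinf.sInf_mem hfin htop subset_rfl
  exact h

theorem residual_le {G : Type u} [Group G] (N : Subgroup G) [hN : N.Normal] (h : F.Mem (G ⧸ N)) :
    F.residual G ≤ N :=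
  sInf_le ⟨hN, h⟩

theorem residual_le_ker {G H : Type u} [Group G] [Group H]
    (f : G →* H) (hf : Function.Surjective f) (h : F.Mem H) : F.residual G ≤ f.ker :=
  residual_le _ (F.of_equiv (QuotientGroup.quotientKerEquivOfSurjective f hf).symm h)

theorem IsFormation.mem_quotient_of_residual_le (hF : F.IsFormation) {G : Type u} [Group G]
    [Finite G] (N : Subgroup G) [N.Normal] (h : F.residual G ≤ N) : F.Mem (G ⧸ N) :=
  hF.of_surjective (QuotientGroup.map (F.residual G) N (MonoidHom.id G) h)
    (QuotientGroup.map_surjective_of_surjective _ N (MonoidHom.id G)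
      (QuotientGroup.mk'_surjective N) h)
    (hF.mem_quotient_residual G)

theorem residual_eq_bot_of_mem {G : Type u} [Group G] (h : F.Mem G) : F.residual G = ⊥ :=
  le_bot_iff.1 (residual_le _ (F.of_equiv QuotientGroup.quotientBot.symm h))

theorem IsFormation.residual_map_of_surjective (hF : F.IsFormation) {G H : Type u} [Group G]
    [Group H] [Finite G] (f : G →* H) (hf : Function.Surjective f) :
    (F.residual G).map f = F.residual H := by
  have : Finite H := Finite.of_surjective f hf
  apply le_antisymm
  · rw [Subgroup.map_le_iff_le_comap]
    have h := residual_le_ker ((QuotientGroup.mk' (F.residual H)).comp f)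
      ((QuotientGroup.mk'_surjective _).comp hf) (hF.mem_quotient_residual H)
    rwa [← MonoidHom.comap_ker, QuotientGroup.ker_mk'] at h
  · have : ((F.residual G).map f).Normal := (F.residual_normal G).map f hf
    refine residual_le _ (hF.of_surjective (QuotientGroup.map (F.residual G) _ f
      (Subgroup.le_comap_map _ _)) ?_ (hF.mem_quotient_residual G))
    exact QuotientGroup.map_surjective_of_surjective _ _ _
      ((QuotientGroup.mk'_surjective _).comp hf) _

theorem IsSubgroupClosed.mem_of_injective (hS : F.IsSubgroupClosed) {G H : Type u} [Group G]
    [Group H] (f : G →* H) (hf : Function.Injective f) (h : F.Mem H) : F.Mem G :=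
  F.of_equiv (MonoidHom.ofInjective hf).symm (hS f.range h)

/-- The quotient of `G` by the preimage of `H^F` embeds in `H/H^F`, so it lies in `F` by
subgroup-closure. -/
theorem IsFormation.residual_le_comap_hom (hF : F.IsFormation) (hS : F.IsSubgroupClosed)
    {G H : Type u} [Group G] [Group H] [Finite H] (f : G →* H) :
    F.residual G ≤ (F.residual H).comap f := by
  refine residual_le _ (hS.mem_of_injective (QuotientGroup.kerLift
    ((QuotientGroup.mk' (F.residual H)).comp f)) (QuotientGroup.kerLift_injective _)
    (hF.mem_quotient_residual H) |> F.of_equiv (QuotientGroup.quotientMulEquivOfEq ?_))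
  rw [← MonoidHom.comap_ker, QuotientGroup.ker_mk']

theorem IsFormation.residualIn_mono (hF : F.IsFormation) (hS : F.IsSubgroupClosed)
    {G : Type u} [Group G] [Finite G] {U V : Subgroup G} (h : U ≤ V) :
    F.residualIn U ≤ F.residualIn V := by
  rw [residualIn, Subgroup.map_le_iff_le_comap]
  intro x hx
  exact ⟨Subgroup.inclusion h x, hF.residual_le_comap_hom hS (Subgroup.inclusion h) hx, rfl⟩

theorem IsFormation.residualIn_map (hF : F.IsFormation) {G H : Type u} [Group G] [Group H]
    [Finite G] (f : G →* H) (U : Subgroup G) :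
    (F.residualIn U).map f = F.residualIn (U.map f) := by
  rw [residualIn, residualIn, ← hF.residual_map_of_surjective (f.subgroupMap U)
    (f.subgroupMap_surjective U), Subgroup.map_map, Subgroup.map_map]
  rfl

theorem residualIn_top (F : GroupClass.{u}) (G : Type u) [Group G] :
    F.residualIn (⊤ : Subgroup G) = F.residual G :=
  F.residual_map Subgroup.topEquiv

theorem IsFormation.residualIn_le_residual (hF : F.IsFormation) (hS : F.IsSubgroupClosed)
    {G : Type u} [Group G] [Finite G] (U : Subgroup G) : F.residualIn U ≤ F.residual G :=
  (hF.residualIn_mono hS le_top).trans (F.residualIn_top G).le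

end GroupClass

/-! ### Elements of `p`-power order and the subgroup `O^p(E)` -/

namespace Subgroup

theorem exists_pow_eq_one_of_dvd_relIndex {G : Type*} [Group G] [Finite G] {p : ℕ}
    [hp : Fact p.Prime] {K L : Subgroup G} (h : p ∣ K.relIndex L) :
    ∃ x ∈ L, x ∉ K ∧ ∃ k : ℕ, x ^ p ^ k = 1 := by
  by_contra! hc
  obtain ⟨P⟩ : Nonempty (Sylow p L) := inferInstance
  have hP : (P : Subgroup L) ≤ K.subgroupOf L := by
    intro x hx
    by_contra hxK
    obtain ⟨k, hk⟩ := P.isPGroup' ⟨x, hx⟩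
    exact hc x x.2 hxK k (by simpa [Subtype.ext_iff] using hk)
  exact P.not_dvd_index (h.trans (index_dvd_of_le hP))

theorem mem_of_pow_mem_of_coprime {G : Type*} [Group G] {M : Subgroup G} {x : G} {n : ℕ}
    (hx : (orderOf x).Coprime n) (h : x ^ n ∈ M) : x ∈ M := by
  obtain ⟨m, hm⟩ := exists_pow_eq_self_of_coprime hx.symm
  rw [← hm]
  exact pow_mem h m

theorem dvd_relIndex_of_pow_eq_one {G : Type*} [Group G] {p : ℕ} [hp : Fact p.Prime]
    {K L : Subgroup G} [hn : (K.subgroupOf L).Normal] {x : G} (hxL : x ∈ L) (hxK : x ∉ K) {k : ℕ}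
    (hk : x ^ p ^ k = 1) : p ∣ K.relIndex L := by
  by_contra hdvd
  have h1 : (p ^ k).Coprime (K.relIndex L) :=
    Nat.Coprime.pow_left k ((Nat.Prime.coprime_iff_not_dvd hp.out).2 hdvd)
  have h2 : (⟨x, hxL⟩ : L) ^ (K.subgroupOf L).index ∈ K.subgroupOf L := pow_index_mem _ _
  exact hxK (mem_of_pow_mem_of_coprime (h1.coprime_dvd_left (orderOf_dvd_of_pow_eq_one hk)) h2)

theorem closure_pow_eq_one_normal {G : Type*} [Group G] (p : ℕ) (T : Subgroup G)
    [hT : T.Normal] : (closure {x | x ∈ T ∧ ∃ k : ℕ, x ^ p ^ k = 1}).Normal := by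
  refine ⟨fun x hx g => ?_⟩
  have : (closure {x | x ∈ T ∧ ∃ k : ℕ, x ^ p ^ k = 1}).map (MulAut.conj g).toMonoidHom ≤
      closure {x | x ∈ T ∧ ∃ k : ℕ, x ^ p ^ k = 1} := by
    rw [MonoidHom.map_closure, closure_le]
    rintro _ ⟨y, ⟨hy, k, hk⟩, rfl⟩
    refine subset_closure ⟨hT.conj_mem y hy g, k, ?_⟩
    rw [← map_pow, hk, map_one]
  exact this ⟨x, hx, rfl⟩

/-- The subgroup `O^p(E)` generated by the `p'`-elements of `E`. -/
def pResidual (p : ℕ) {G : Type*} [Group G] (E : Subgroup G) : Subgroup G :=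
  closure {x | x ∈ E ∧ (orderOf x).Coprime p}

section pResidual

variable {G : Type*} [Group G] {p : ℕ}

theorem pResidual_le (E : Subgroup G) : pResidual p E ≤ E :=
  (closure_le _).2 fun _ hx => hx.1

theorem pResidual_mono {E E' : Subgroup G} (h : E ≤ E') : pResidual p E ≤ pResidual p E' :=
  closure_mono fun _ hx => ⟨h hx.1, hx.2⟩

theorem conj_mem_pResidual {E : Subgroup G} {g x : G} (hg : ∀ y ∈ E, g * y * g⁻¹ ∈ E)
    (hx : x ∈ pResidual p E) : g * x * g⁻¹ ∈ pResidual p E := by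
  induction hx using closure_induction with
  | mem y hy =>
    refine subset_closure ⟨hg y hy.1, ?_⟩
    rw [← MulAut.conj_apply, MulEquiv.orderOf_eq]
    exact hy.2
  | one => simp
  | mul y z _ _ h1 h2 => simpa using mul_mem h1 h2
  | inv y _ h => simpa [mul_assoc] using inv_mem h

/-- Each generator is a power of its own `p ^ k`-th power. This is the form in which `O^p(O^p(E)) =
O^p(E)` gets used; `M` need not be normal. -/
theorem pResidual_le_of_pow_mem {E M : Subgroup G}
    (h : ∀ x ∈ pResidual p E, ∃ k : ℕ, x ^ p ^ k ∈ M) : pResidual p E ≤ M := by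
  refine (closure_le _).2 fun x hx => ?_
  obtain ⟨k, hk⟩ := h x (subset_closure hx)
  exact mem_of_pow_mem_of_coprime (hx.2.pow_right k) hk

theorem exists_pow_coprime [Finite G] [hp : Fact p.Prime] (x : G) :
    ∃ k : ℕ, (orderOf (x ^ p ^ k)).Coprime p := by
  obtain ⟨k, m, hm, h⟩ := Nat.exists_eq_pow_mul_and_not_dvd (orderOf_pos x).ne' p hp.out.ne_one
  refine ⟨k, ?_⟩
  have h1 : orderOf (x ^ p ^ k) = m := by
    rw [orderOf_pow_of_dvd (pow_ne_zero _ hp.out.ne_zero) (h ▸ dvd_mul_right _ _), h,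
      Nat.mul_div_cancel_left _ (pow_pos hp.out.pos _)]
  rw [h1]
  exact ((Nat.Prime.coprime_iff_not_dvd hp.out).2 hm).symm

theorem exists_pow_mem_pResidual [Finite G] [hp : Fact p.Prime] {E : Subgroup G} {x : G}
    (hx : x ∈ E) : ∃ k : ℕ, x ^ p ^ k ∈ pResidual p E := by
  obtain ⟨k, hk⟩ := exists_pow_coprime (p := p) x
  exact ⟨k, subset_closure ⟨pow_mem hx _, hk⟩⟩

/-- A `p'`-element of the image need not have its given preimage a `p'`-element, but some `p`-power
of the preimage is one, and a `p'`-element is recovered from its `p`-powers. -/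
theorem pResidual_map [Finite G] [hp : Fact p.Prime] {H : Type*} [Group H] (f : G →* H)
    (E : Subgroup G) : (pResidual p E).map f = pResidual p (E.map f) := by
  apply le_antisymm
  · rw [pResidual, MonoidHom.map_closure, closure_le]
    rintro _ ⟨x, hx, rfl⟩
    exact subset_closure ⟨⟨x, hx.1, rfl⟩, hx.2.coprime_dvd_left (orderOf_map_dvd f x)⟩
  · refine (closure_le _).2 ?_
    rintro _ ⟨⟨x, hx, rfl⟩, h⟩
    obtain ⟨k, hk⟩ := exists_pow_mem_pResidual (p := p) hx
    exact mem_of_pow_mem_of_coprime (h.pow_right k) ⟨_, hk, map_pow f _ _⟩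

end pResidual

/-! ### Conjugacy of complements to an abelian normal Hall subgroup -/

section Complement

open MulAction MulOpposite
open scoped Pointwise

variable {G : Type*} [Group G] [Finite G]

/-- The complement `K` is itself a transversal of `P` and fixes its own class in `P.QuotientDiff`;
the stabiliser is also a complement, so the orders agree. As `P` is transitive on these classes,
complements are conjugate. -/
theorem IsComplement'.eq_stabilizer {P K : Subgroup G} [P.Normal] [IsMulCommutative P]
    (hP : (Nat.card P).Coprime P.index) (h : IsComplement' P K) :
    ∃ α : P.QuotientDiff, K = stabilizer G α := by
  refine ⟨Quotient.mk'' ⟨K, h.symm⟩, ?_⟩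
  refine eq_of_le_of_card_ge ?_ ?_
  · intro k hk
    refine mem_stabilizer_iff.2 ?_
    refine congr_arg Quotient.mk'' (Subtype.ext ?_)
    exact op_smul_coe_set (inv_mem hk)
  · have h1 := h.card_mul_card
    have h2 := (isComplement'_stabilizer_of_coprime (α := Quotient.mk'' ⟨K, h.symm⟩) hP).card_mul_card
    exact (Nat.eq_of_mul_eq_mul_left Nat.card_pos (h2.trans h1.symm)).le

theorem IsComplement'.exists_map_conj_eq {P K₁ K₂ : Subgroup G} [P.Normal] [IsMulCommutative P]
    (hP : (Nat.card P).Coprime P.index) (h₁ : IsComplement' P K₁) (h₂ : IsComplement' P K₂) :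
    ∃ x ∈ P, K₂ = K₁.map (MulAut.conj x).toMonoidHom := by
  obtain ⟨α, rfl⟩ := h₁.eq_stabilizer hP
  obtain ⟨β, rfl⟩ := h₂.eq_stabilizer hP
  obtain ⟨x, rfl⟩ := exists_smul_eq hP α β
  exact ⟨x, x.2, stabilizer_smul_eq_stabilizer_map_conj (x : G) α⟩

end Complement
end Subgroup

namespace Subgroup

/-! ### Normal Hall subgroups inside the Frattini subgroup -/

section Frattini

variable {H : Type*} [Group H] [Finite H]

/-- Frattini argument: the complements of `P` in `T` are conjugate under `P`, so `H = P N_H(Q)` for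
a complement `Q`. Since `P ≤ Φ(H)`, already `N_H(Q) = H`. -/
theorem exists_normal_sup_eq_of_le_frattini {P T : Subgroup H} [hPn : P.Normal] [hTn : T.Normal]
    [IsMulCommutative P] (hPT : P ≤ T) (hc : (Nat.card P).Coprime (P.relIndex T))
    (hP : P ≤ frattini H) : ∃ Q : Subgroup H, Q.Normal ∧ P ⊔ Q = T ∧ Disjoint P Q := by
  have hcard : Nat.card (P.subgroupOf T) = Nat.card P :=
    Nat.card_congr (subgroupOfEquivOfLe hPT).toEquiv
  have hc' : (Nat.card (P.subgroupOf T)).Coprime (P.subgroupOf T).index := by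
    rw [hcard]; exact hc
  have hcomm : IsMulCommutative (P.subgroupOf T) :=
    ⟨⟨fun a b => (subgroupOfEquivOfLe hPT).injective (by
      rw [map_mul, map_mul]; exact mul_comm' _ _)⟩⟩
  obtain ⟨K, hK⟩ := exists_right_complement'_of_coprime hc'
  have hmapP : (P.subgroupOf T).map T.subtype = P := by
    rw [subgroupOf_map_subtype, inf_eq_left.2 hPT]
  refine ⟨K.map T.subtype, ?_, ?_, ?_⟩
  · rw [← normalizer_eq_top_iff]
    apply frattini_nongenerating
    rw [eq_top_iff]
    intro h _
    have hcomp : IsComplement' (P.subgroupOf T) (K.map (MulAut.conjNormal h).toMonoidHom) := by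
      have hcK : Nat.card (K.map (MulAut.conjNormal h).toMonoidHom) = Nat.card K :=
        card_map_of_injective (MulAut.conjNormal h).injective
      refine isComplement'_of_coprime ?_ ?_
      · rw [hcK]; exact hK.card_mul_card
      · rw [hcK, ← hK.symm.index_eq_card]; exact hc'
    obtain ⟨x, hx, he⟩ := hK.exists_map_conj_eq hc' hcomp
    have hmem : (x : H)⁻¹ * h ∈ normalizer (K.map T.subtype : Set H) := by
      refine mem_normalizer_fintype ?_
      rintro _ ⟨k, hk, rfl⟩
      have h1 : MulAut.conjNormal h k ∈ K.map (MulAut.conj x).toMonoidHom :=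
        he ▸ mem_map_of_mem _ hk
      obtain ⟨k', hk', h2⟩ := h1
      refine ⟨k', hk', ?_⟩
      have h3 : (x : H) * k' * (x : H)⁻¹ = h * k * h⁻¹ := by
        simpa using congr_arg Subtype.val h2
      simp only [subtype_apply, mul_inv_rev, inv_inv]
      calc (k' : H) = (x : H)⁻¹ * (x * k' * (x : H)⁻¹) * x := by group
        _ = _ := by rw [h3]; group
    rw [sup_comm]
    have h5 := mul_mem (mem_sup_left (hP hx) : (x : H) ∈ frattini H ⊔ _) (mem_sup_right hmem)
    rwa [mul_inv_cancel_left] at h5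
  · rw [← hmapP, ← map_sup, hK.sup_eq_top, ← MonoidHom.range_eq_map, range_subtype]
  · rw [← hmapP]
    exact disjoint_map T.subtype_injective hK.disjoint

/-- If `P ≠ 1`, pass to `H/P'` with `P' < P`: the normal complement found there pulls back to a
normal supplement of `P` in `T`, hence to `T` itself, which forces `P = P'`. -/
theorem eq_bot_of_le_frattini {P T : Subgroup H} [hPn : P.Normal] [hTn : T.Normal]
    (hsol : Group.IsSolvable P) (hPT : P ≤ T) (hc : (Nat.card P).Coprime (P.relIndex T))
    (hP : P ≤ frattini H) (hT : ∀ M : Subgroup H, M.Normal → P ⊔ M = T → M = T) : P = ⊥ := by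
  by_contra hne
  have hlt : ⁅P, P⁆ < P := by
    have := (nontrivial_iff_ne_bot P).2 hne
    have h := Group.IsSolvable.commutator_lt_top_of_nontrivial P
    rwa [_root_.commutator_def, ← map_subtype_lt_map_subtype, map_commutator, ← MonoidHom.range_eq_map,
      range_subtype] at h
  set f := QuotientGroup.mk' ⁅P, P⁆ with hf
  have hfs : Function.Surjective f := QuotientGroup.mk'_surjective _
  have hker : f.ker = ⁅P, P⁆ := QuotientGroup.ker_mk' _
  have : (P.map f).Normal := hPn.map f hfs
  have : (T.map f).Normal := hTn.map f hfs
  have hcomm : IsMulCommutative (P.map f) := by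
    rw [← commutator_self_eq_bot_iff, ← map_commutator, map_eq_bot_iff, hker]
  have hc' : (Nat.card (P.map f)).Coprime ((P.map f).relIndex (T.map f)) := by
    refine (hc.coprime_dvd_left (card_map_dvd P f)).coprime_dvd_right ?_
    rw [relIndex_map_map]
    exact (relIndex_dvd_of_le_left _ le_sup_left).trans
      (by rw [sup_eq_left.2 (hker.le.trans (hlt.le.trans hPT))])
  obtain ⟨Q, hQ, hPQ, hdisj⟩ := exists_normal_sup_eq_of_le_frattini (map_mono hPT) hc'
    ((map_mono hP).trans (map_le_iff_le_comap.2 (frattini_le_comap_frattini_of_surjective hfs)))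
  have hQT : Q.comap f = T := by
    refine hT _ (hQ.comap f) ?_
    have h1 : P ⊔ Q.comap f = (P.map f ⊔ Q).comap f := by
      rw [← comap_sup_eq f _ _ hfs, comap_map_eq, hker, sup_eq_left.2 hlt.le]
    rw [h1, hPQ, comap_map_eq, hker, sup_eq_left.2 (hlt.le.trans hPT)]
  have hle : P.map f ≤ Q := map_le_iff_le_comap.2 (hPT.trans hQT.ge)
  have h2 : P.map f = ⊥ := disjoint_self.1 (hdisj.mono_right hle)
  rw [map_eq_bot_iff, hker] at h2
  exact absurd h2 hlt.not_ge

end Frattini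
end Subgroup

/-! ### Radicals of `π`-groups and the `p'`-argument for `O^p(U^F)` -/

namespace GroupClass

instance radical_normal (X : GroupClass.{u}) (G : Type u) [Group G] : (X.radical G).Normal :=
  ⟨fun n hn g => X.radical_map_le (MulAut.conj g) ⟨n, hn, rfl⟩⟩

theorem le_radical {X : GroupClass.{u}} {G : Type u} [Group G] {N : Subgroup G} (hN : N.Normal)
    (h : X.Mem N) : N ≤ X.radical G :=
  le_sSup ⟨hN, h⟩

theorem piGroups_mem_bot (π : Set Nat.Primes) (G : Type u) [Group G] :
    (piGroups π).Mem (⊥ : Subgroup G) :=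
  ⟨inferInstance, fun p hp => absurd (by simpa using hp) p.2.ne_one⟩

theorem piGroups_mem_of_dvd {π : Set Nat.Primes} {G H : Type u} [Group G] [Group H] [Finite H]
    (h : (piGroups π).Mem G) (hd : Nat.card H ∣ Nat.card G) : (piGroups π).Mem H :=
  ⟨inferInstance, fun p hp => h.2 p (hp.trans hd)⟩

theorem piGroups_radical_mem (π : Set Nat.Primes) (G : Type u) [Group G] [Finite G] :
    (piGroups π).Mem ((piGroups π).radical G) := by
  have hsup : SupClosed {N : Subgroup G | N.Normal ∧ (piGroups π).Mem N} := by
    rintro M ⟨hM, h1⟩ N ⟨hN, h2⟩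
    refine ⟨inferInstance, inferInstance, fun p hp => ?_⟩
    rw [← Subgroup.relIndex_bot_left, ← Subgroup.relIndex_mul_relIndex ⊥ M (M ⊔ N) bot_le
      le_sup_left, Subgroup.relIndex_sup_left, Subgroup.relIndex_bot_left] at hp
    rcases (Nat.Prime.dvd_mul p.2).1 hp with h | h
    · exact h1.2 p h
    · exact h2.2 p (h.trans (Subgroup.relIndex_dvd_card _ _))
  exact (hsup.sSup_mem (Set.toFinite _) ⟨inferInstance, piGroups_mem_bot π G⟩ subset_rfl).2

theorem piGroups_radical_map_le (π : Set Nat.Primes) {G H : Type u} [Group G] [Group H] [Finite G]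
    (f : G →* H) (hf : Function.Surjective f) :
    ((piGroups π).radical G).map f ≤ (piGroups π).radical H := by
  have : Finite H := Finite.of_surjective f hf
  exact le_radical ((radical_normal _ G).map f hf)
    (piGroups_mem_of_dvd (piGroups_radical_mem π G) (Subgroup.card_map_dvd _ f))

theorem piGroups_radical_quotient (π : Set Nat.Primes) (G : Type u) [Group G] [Finite G] :
    (piGroups π).radical (G ⧸ (piGroups π).radical G) = ⊥ := by
  set O := (piGroups π).radical G with hO
  set f := QuotientGroup.mk' O with hf
  have hfs : Function.Surjective f := QuotientGroup.mk'_surjective _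
  have hker : f.ker = O := QuotientGroup.ker_mk' _
  have hle : O ≤ ((piGroups π).radical (G ⧸ O)).comap f := hker.ge.trans (f.ker_le_comap _)
  have h1 : ((piGroups π).radical (G ⧸ O)).comap f ≤ O := by
    refine le_radical inferInstance ⟨inferInstance, fun p hp => ?_⟩
    rw [← Subgroup.relIndex_bot_left, ← Subgroup.relIndex_mul_relIndex ⊥ O _ bot_le hle,
      Subgroup.relIndex_bot_left] at hp
    rcases (Nat.Prime.dvd_mul p.2).1 hp with h | h
    · exact (piGroups_radical_mem π G).2 p h
    · have h2 : O.relIndex _ = Nat.card _ := (congr_arg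
        (Subgroup.relIndex · (((piGroups π).radical (G ⧸ O)).comap f)) hker.symm).trans
        (Subgroup.relIndex_ker _ f)
      rw [h2, Subgroup.map_comap_eq_self_of_surjective hfs] at h
      exact (piGroups_radical_mem π (G ⧸ O)).2 p h
  rw [← Subgroup.map_comap_eq_self_of_surjective hfs ((piGroups π).radical (G ⧸ O)),
    Subgroup.map_eq_bot_iff, hker]
  exact h1

/-- `O_{p'}(L)` is characteristic in the minimal normal subgroup `L` and proper because `p ∣ |L|`,
hence trivial; it contains `B`. -/
theorem eq_bot_of_isChiefFactor_of_not_dvd {G : Type u} [Group G] [Finite G] {L B : Subgroup G}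
    (hL : IsChiefFactor ⊥ L) (p : Nat.Primes) (hp : (p : ℕ) ∣ Nat.card L) (hBL : B ≤ L)
    (hB : (B.subgroupOf L).Normal) (hpB : ¬ (p : ℕ) ∣ Nat.card B) : B = ⊥ := by
  have hLn := hL.normal_top
  set O := (piGroups ({p}ᶜ : Set Nat.Primes)).radical L with hO
  have hchar : O.Characteristic := Subgroup.characteristic_iff_map_le.2
    fun e => (piGroups ({p}ᶜ : Set Nat.Primes)).radical_map_le e
  have hOp : ¬ (p : ℕ) ∣ Nat.card O := fun h => (piGroups_radical_mem _ L).2 p h rfl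
  have hcard : Nat.card (O.map L.subtype) = Nat.card O :=
    Subgroup.card_map_of_injective L.subtype_injective
  have h1 : B.subgroupOf L ≤ O := by
    refine le_radical hB ⟨inferInstance, fun q hq => ?_⟩
    rintro rfl
    rw [Nat.card_congr (Subgroup.subgroupOfEquivOfLe hBL).toEquiv] at hq
    exact hpB hq
  have h2 : B ≤ O.map L.subtype := by
    rw [← inf_eq_left.2 hBL, ← Subgroup.subgroupOf_map_subtype]
    exact Subgroup.map_mono h1
  rcases hL.eq_or_eq (O.map L.subtype) inferInstance bot_le (Subgroup.map_subtype_le _) with h | h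
  · exact le_bot_iff.1 (h ▸ h2)
  · rw [← hcard, h] at hOp
    exact absurd hp hOp

open Subgroup in
-- All `p`-elements of `T = O^p(U^F)` turn out to lie in the nilpotent group `Φ(U)`, so `T` has a
-- normal Sylow `p`-subgroup `P ≤ Φ(U)`. A normal `M'` with `P M' = T` has `p`-power index, so `M' =
-- T`, and `eq_bot_of_le_frattini` gives `P = 1`.
theorem not_dvd_card_pResidual_residual {F : GroupClass.{u}} (hF : F.IsFormation)
    (hS : F.IsSubgroupClosed) {U : Type u} [Group U] [Finite U] {p : ℕ} [hp : Fact p.Prime]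
    {D : Subgroup U} [hD : D.Normal] (hV : ∀ V : Subgroup U, V ≠ ⊤ → pResidual p (F.residualIn V) ≤ D)
    (hM : ∃ M < pResidual p (F.residual U), pResidual p (F.residual U) ⊓ D ≤ M ∧
      (M.subgroupOf (pResidual p (F.residual U))).Normal ∧
      ¬ p ∣ M.relIndex (pResidual p (F.residual U))) :
    ¬ p ∣ Nat.card (pResidual p (F.residual U)) := by
  obtain ⟨M, hMT, hDM, hMn, hpM⟩ := hM
  set T := pResidual p (F.residual U) with hT
  have hTn : T.Normal := ⟨fun x hx g => conj_mem_pResidual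
    (fun y hy => (F.residual_normal U).conj_mem y hy g) hx⟩
  set S : Set U := {x | x ∈ T ∧ ∃ k : ℕ, x ^ p ^ k = 1} with hSdef
  have hSn : (closure S).Normal := closure_pow_eq_one_normal p T
  set Y := (T ⊓ D) ⊔ closure S with hY
  have hYn : Y.Normal := inferInstance
  have hYM : Y ≤ M := by
    refine sup_le hDM ((closure_le _).2 ?_)
    rintro x ⟨hx, k, hk⟩
    by_contra hxM
    exact hpM (dvd_relIndex_of_pow_eq_one hx hxM hk)
  -- If a maximal `V` did not contain `Y`, then `U = VY`, so modulo `Y` the images of `T` and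
  -- `O^p(V^F)` coincide. The latter lies in `T ∩ D ≤ Y`, giving `T ≤ Y ≤ M < T`.
  have hYf : Y ≤ frattini U := by
    refine le_iInf₂ fun V hVc => ?_
    by_contra hYV
    have hVY : V ⊔ Y = ⊤ := hVc.2 _ (left_lt_sup.2 hYV)
    set f := QuotientGroup.mk' Y with hf
    have hfs : Function.Surjective f := QuotientGroup.mk'_surjective _
    have hker : f.ker = Y := QuotientGroup.ker_mk' _
    have h1 : V.map f = ⊤ := by
      have := congr_arg (map f) hVY
      rwa [Subgroup.map_sup, (Subgroup.map_eq_bot_iff Y).2 hker.ge, sup_bot_eq, map_top_of_surjective f hfs] at this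
    have h2 : T.map f = (pResidual p (F.residualIn V)).map f := by
      rw [hT, pResidual_map, pResidual_map, hF.residualIn_map, h1, residualIn_top,
        hF.residual_map_of_surjective f hfs]
    have h3 : pResidual p (F.residualIn V) ≤ Y :=
      (le_inf (pResidual_mono (hF.residualIn_le_residual hS V)) (hV V hVc.1)).trans le_sup_left
    have h4 : T.map f = ⊥ := by
      rw [h2, Subgroup.map_eq_bot_iff, hker]; exact h3
    rw [Subgroup.map_eq_bot_iff, hker] at h4
    exact hMT.not_ge (h4.trans hYM)
  obtain ⟨Q⟩ : Nonempty (Sylow p (frattini U)) := inferInstance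
  have hQn : (Q : Subgroup (frattini U)).Normal := by
    have h := (Group.isNilpotent_of_finite_tfae (G := frattini U)).out 0 3
    exact h.1 frattini_nilpotent p hp Q
  have hQc : (Q : Subgroup (frattini U)).Characteristic := Q.characteristic_of_normal hQn
  set P := T ⊓ (Q : Subgroup (frattini U)).map (frattini U).subtype with hP
  have hPn : P.Normal := inferInstance
  have hPp : IsPGroup p P := (Q.isPGroup'.map _).to_inf_right
  have hPT : ¬ p ∣ P.relIndex T := by
    intro h
    obtain ⟨x, hx, hxP, k, hk⟩ := exists_pow_eq_one_of_dvd_relIndex h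
    have hxf : x ∈ frattini U := hYf (mem_sup_right (subset_closure ⟨hx, k, hk⟩))
    refine hxP ⟨hx, ⟨x, hxf⟩, ?_, rfl⟩
    by_contra hxQ
    refine Q.not_dvd_index ?_
    rw [← relIndex_top_right]
    exact dvd_relIndex_of_pow_eq_one (k := k) (mem_top _) hxQ (Subtype.ext hk)
  have hPbot : P = ⊥ := by
    have hnil : Group.IsNilpotent P := hPp.isNilpotent
    refine eq_bot_of_le_frattini (T := T) inferInstance inf_le_left ?_
      (inf_le_right.trans (map_subtype_le _)) fun M' hM' hsup => ?_
    · obtain ⟨n, hn⟩ := IsPGroup.iff_card.1 hPp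
      rw [hn]
      exact ((Nat.Prime.coprime_iff_not_dvd hp.out).2 hPT).pow_left n
    · refine le_antisymm (hsup ▸ le_sup_right) (pResidual_le_of_pow_mem fun x hx => ?_)
      rw [← hT, ← hsup, mem_sup_of_normal_right] at hx
      obtain ⟨y, hy, m, hm, rfl⟩ := hx
      obtain ⟨k, hk⟩ := hPp ⟨y, hy⟩
      have hk' : y ^ p ^ k = 1 := congr_arg Subtype.val hk
      refine ⟨k, (QuotientGroup.eq_one_iff _).1 ?_⟩
      rw [QuotientGroup.mk_pow, QuotientGroup.mk_mul, (QuotientGroup.eq_one_iff m).2 hm, mul_one,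
        ← QuotientGroup.mk_pow, hk', QuotientGroup.mk_one]
  rwa [hPbot, relIndex_bot_left] at hPT

end GroupClass

/-! ### Minimal normal subgroups that normalise all residuals -/

open Subgroup
open scoped commutatorElement

theorem exists_isChiefFactor_top {G : Type u} [Group G] [Finite G] {N L : Subgroup G}
    (hN : N.Normal) (hL : L.Normal) (h : N < L) : ∃ M, N ≤ M ∧ IsChiefFactor M L := by
  obtain ⟨M, ⟨hM, hNM, hML⟩, hmax⟩ := wellFounded_gt.has_min
    {M : Subgroup G | M.Normal ∧ N ≤ M ∧ M < L} ⟨N, hN, le_rfl, h⟩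
  refine ⟨M, hNM, hM, hL, hML, fun M' hM' h1 h2 => ?_⟩
  by_contra! hne
  exact hmax M' ⟨hM', hNM.trans h1, lt_of_le_of_ne h2 hne.2⟩ (lt_of_le_of_ne h1 hne.1.symm)

theorem exists_isChiefFactor_bot {G : Type u} [Group G] [Finite G] {N L : Subgroup G}
    (hN : N.Normal) (hL : L.Normal) (h : N < L) : ∃ M ≤ L, IsChiefFactor N M := by
  obtain ⟨M, ⟨hM, hNM, hML⟩, hmin⟩ := wellFounded_lt.has_min
    {M : Subgroup G | M.Normal ∧ N < M ∧ M ≤ L} ⟨L, hL, h, le_rfl⟩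
  refine ⟨M, hML, hN, hM, hNM, fun M' hM' h1 h2 => ?_⟩
  by_contra! hne
  exact hmin M' ⟨hM', lt_of_le_of_ne h1 hne.1.symm, h2.trans hML⟩ (lt_of_le_of_ne h2 hne.2)

namespace GroupClass

/-- Take `L` minimal among normal subgroups of `R` whose preimage supplements `D`, and a chief
factor `L/M` of `R`. The preimage of `M` times `D` is proper, and contains all `|L/M|`-th powers.
Working with chief factors of `R` avoids proving that subgroups of `π`-solvable groups are
`π`-solvable. -/
theorem exists_normal_of_piSolvable {π : Set Nat.Primes} {p : Nat.Primes} (hp : p ∈ π)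
    {T R : Type u} [Group T] [Group R] [Finite T] (hR : (piSolvableGroups π).Mem R) (ψ : T →* R)
    {D : Subgroup T} [hDn : D.Normal] (hD : D ≠ ⊤) (hker : ψ.ker ≤ D) :
    ∃ M : Subgroup T, M.Normal ∧ M ≠ ⊤ ∧ D ≤ M ∧
      (¬ (p : ℕ) ∣ M.index ∨ ∀ x : T, ∃ k : ℕ, x ^ (p : ℕ) ^ k ∈ M) := by
  have hfin : Finite R := hR.1
  have hpp : Fact (p : ℕ).Prime := ⟨p.2⟩
  obtain ⟨L, ⟨hLn, hL⟩, hmin⟩ := wellFounded_lt.has_min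
    {L : Subgroup R | L.Normal ∧ L.comap ψ ⊔ D = ⊤} ⟨⊤, inferInstance, by simp⟩
  have hLbot : ⊥ < L := by
    rw [bot_lt_iff_ne_bot]
    rintro rfl
    rw [MonoidHom.comap_bot, sup_eq_right.2 hker] at hL
    exact hD hL
  obtain ⟨M, -, hM⟩ := exists_isChiefFactor_top inferInstance hLn hLbot
  have hMn := hM.normal_bot
  have hpow : ∀ x : T, x ^ M.relIndex L ∈ M.comap ψ ⊔ D := by
    intro x
    have hx : x ∈ L.comap ψ ⊔ D := hL ▸ mem_top x
    rw [mem_sup_of_normal_right] at hx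
    obtain ⟨y, hy, d, hd, rfl⟩ := hx
    have h1 : y ^ M.relIndex L ∈ M.comap ψ := by
      have h2 : (⟨ψ y, hy⟩ : L) ^ (M.subgroupOf L).index ∈ M.subgroupOf L := pow_index_mem _ _
      rw [mem_comap, map_pow]
      exact h2
    refine (QuotientGroup.eq_one_iff _).1 ?_
    rw [QuotientGroup.mk_pow, QuotientGroup.mk_mul,
      (QuotientGroup.eq_one_iff d).2 (mem_sup_right hd), mul_one, ← QuotientGroup.mk_pow]
    exact (QuotientGroup.eq_one_iff _).2 (mem_sup_left h1)
  refine ⟨M.comap ψ ⊔ D, inferInstance, fun h => hmin M ⟨hMn, h⟩ hM.lt, le_sup_right, ?_⟩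
  by_cases hdvd : (p : ℕ) ∣ M.relIndex L
  · right
    rcases hR.2 M L hM with h | ⟨q, hq, n, hn⟩
    · exact absurd hdvd (h p hp)
    · rw [hn] at hdvd hpow
      have hpq : (p : ℕ) = q := (Nat.prime_dvd_prime_iff_eq p.2 q.2).1 (p.2.dvd_of_dvd_pow hdvd)
      exact fun x => ⟨n, hpq ▸ hpow x⟩
  · left
    intro h
    rw [← relIndex_top_right] at h
    obtain ⟨x, -, hx, k, hk⟩ := exists_pow_eq_one_of_dvd_relIndex h
    refine hx (mem_of_pow_mem_of_coprime ?_ (hpow x))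
    exact (((Nat.Prime.coprime_iff_not_dvd p.2).2 hdvd).pow_left k).coprime_dvd_left
      (orderOf_dvd_of_pow_eq_one hk)

theorem piGroups_singleton_mem_iff {p : Nat.Primes} {G : Type u} [Group G] [Finite G] :
    (piGroups {p}).Mem G ↔ IsPGroup p G := by
  have hpp : Fact (p : ℕ).Prime := ⟨p.2⟩
  constructor
  · intro h
    rw [IsPGroup.iff_card]
    refine ⟨_, Nat.eq_prime_pow_of_unique_prime_dvd Nat.card_pos.ne' fun hq hd => ?_⟩
    exact congr_arg Subtype.val (h.2 ⟨_, hq⟩ hd)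
  · intro h
    refine ⟨inferInstance, fun q hq => ?_⟩
    obtain ⟨n, hn⟩ := IsPGroup.iff_card.1 h
    rw [hn] at hq
    exact Subtype.ext ((Nat.prime_dvd_prime_iff_eq q.2 p.2).1 (q.2.dvd_of_dvd_pow hq))

theorem isPGroup_iff_pResidual_eq_bot {p : ℕ} [Fact p.Prime] {G : Type u} [Group G] [Finite G]
    {E : Subgroup G} : IsPGroup p E ↔ pResidual p E = ⊥ := by
  constructor
  · intro h
    refine le_bot_iff.1 (pResidual_le_of_pow_mem fun x hx => ?_)
    obtain ⟨k, hk⟩ := h ⟨x, pResidual_le E hx⟩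
    exact ⟨k, mem_bot.2 (congr_arg Subtype.val hk)⟩
  · rintro h ⟨x, hx⟩
    obtain ⟨k, hk⟩ := exists_pow_mem_pResidual (p := p) hx
    rw [h, mem_bot] at hk
    exact ⟨k, Subtype.ext hk⟩

theorem isCritical_quotient {F : GroupClass.{u}} (hF : F.IsFormation) {p : Nat.Primes}
    {U : Type u} [Group U] [Finite U] {D : Subgroup U} [hD : D.Normal]
    (hT : ¬ pResidual p (F.residual U) ≤ D)
    (hV : ∀ V : Subgroup U, V ≠ ⊤ → pResidual p (F.residualIn V) ≤ D) :
    IsCritical (formationProduct (piGroups {p}) F) (U ⧸ D) := by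
  have hpp : Fact (p : ℕ).Prime := ⟨p.2⟩
  set f := QuotientGroup.mk' D with hf
  have hfs : Function.Surjective f := QuotientGroup.mk'_surjective _
  have hker : f.ker = D := QuotientGroup.ker_mk' _
  refine ⟨inferInstance, fun h => hT ?_, fun W hW => ⟨inferInstance, ?_⟩⟩
  · have h1 := isPGroup_iff_pResidual_eq_bot.1 (piGroups_singleton_mem_iff.1 h.2)
    rwa [← hF.residual_map_of_surjective f hfs, ← pResidual_map, Subgroup.map_eq_bot_iff, hker]
      at h1
  · have h1 : pResidual p (F.residualIn W) = ⊥ := by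
      rw [← map_comap_eq_self_of_surjective hfs W, ← hF.residualIn_map, ← pResidual_map,
        Subgroup.map_eq_bot_iff, hker]
      exact hV _ fun h => hW (by
        rw [← map_comap_eq_self_of_surjective hfs W, h, map_top_of_surjective f hfs])
    refine (piGroups {p}).of_equiv ((F.residual W).equivMapOfInjective W.subtype
      W.subtype_injective).symm ?_
    exact piGroups_singleton_mem_iff.2 (isPGroup_iff_pResidual_eq_bot.2 h1)

/-- In a minimal counterexample `U`, the `p`-power alternative for `M` is excluded by `O^p(T) = T`.
The `p'`-index alternative makes `T` a `p'`-group normalised by `L`, so `[L, T] ≤ L ∩ T = 1`. -/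
theorem pResidual_residual_le_centralizer {F : GroupClass.{u}} (hF : F.IsFormation)
    (hS : F.IsSubgroupClosed) {π : Set Nat.Primes} {p : Nat.Primes} (hpπ : p ∈ π) {G : Type u}
    [Group G] [Finite G]
    (h : (formationProduct (piSolvableGroups π) F).Mem G ∨ BoundaryConditionII π F)
    {L : Subgroup G} (hL : IsChiefFactor ⊥ L) (hp : (p : ℕ) ∣ Nat.card L)
    (hnorm : ∀ U : Subgroup G, L ≤ normalizer (F.residualIn U : Set G)) :
    pResidual p (F.residual G) ≤ centralizer L := by
  have hpp : Fact (p : ℕ).Prime := ⟨p.2⟩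
  have hLn := hL.normal_top
  by_contra hcon
  obtain ⟨U, hU, hmin⟩ := wellFounded_lt.has_min
    {U : Subgroup G | ¬ pResidual p (F.residualIn U) ≤ centralizer L}
    ⟨⊤, by rwa [← residualIn_top] at hcon⟩
  set D := (centralizer (L : Set G)).subgroupOf U with hD
  set T := pResidual p (F.residual U) with hT
  have hTmap : T.map U.subtype = pResidual p (F.residualIn U) := pResidual_map _ _
  have hTD : ¬ T ≤ D := by
    rw [hD, subgroupOf, ← map_le_iff_le_comap, hTmap]
    exact hU
  have hV : ∀ V : Subgroup U, V ≠ ⊤ → pResidual p (F.residualIn V) ≤ D := by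
    intro V hV
    rw [hD, subgroupOf, ← map_le_iff_le_comap, pResidual_map, hF.residualIn_map]
    by_contra hc
    refine hmin (V.map U.subtype) hc (lt_of_le_of_ne (map_subtype_le V) fun he => hV ?_)
    rw [← comap_map_eq_self_of_injective U.subtype_injective V, he]
    exact subgroupOf_self U
  have hDT : D.subgroupOf T ≠ ⊤ := fun h => hTD (subgroupOf_eq_top.1 h)
  have hsep : ∃ M : Subgroup T, M.Normal ∧ M ≠ ⊤ ∧ D.subgroupOf T ≤ M ∧
      (¬ (p : ℕ) ∣ M.index ∨ ∀ x : T, ∃ k : ℕ, x ^ (p : ℕ) ^ k ∈ M) := by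
    -- In the first case `T` embeds in the `π`-solvable group `G^F`. In the second, minimality makes
    -- `U/D` critical, so `T/(T ∩ D)` embeds in a `π`-solvable residual.
    rcases h with h | h
    · have hmem : ∀ x : T, (U.subtype.comp T.subtype) x ∈ F.residual G := fun x =>
        hF.residualIn_le_residual hS U (pResidual_le _ (hTmap ▸ mem_map_of_mem _ x.2))
      refine exists_normal_of_piSolvable hpπ h.2
        ((U.subtype.comp T.subtype).codRestrict (F.residual G) hmem) hDT ?_
      rintro x hx
      have h1 : ((x : U) : G) = 1 := congr_arg Subtype.val (MonoidHom.mem_ker.1 hx)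
      rw [show x = 1 from Subtype.ext (Subtype.ext h1)]
      exact one_mem _
    · have h1 := h p hpπ _ (isCritical_quotient hF hTD hV)
      have hmem : ∀ x : T, ((QuotientGroup.mk' D).comp T.subtype) x ∈ F.residual (U ⧸ D) := by
        intro x
        rw [← hF.residual_map_of_surjective _ (QuotientGroup.mk'_surjective D)]
        exact mem_map_of_mem _ (pResidual_le _ x.2)
      refine exists_normal_of_piSolvable hpπ h1.2
        (((QuotientGroup.mk' D).comp T.subtype).codRestrict _ hmem) hDT ?_
      rintro x hx
      exact (QuotientGroup.eq_one_iff (x : U)).1 (congr_arg Subtype.val (MonoidHom.mem_ker.1 hx))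
  obtain ⟨M, hMn, hMtop, hDM, hM⟩ := hsep
  have hMT : (M.map T.subtype).subgroupOf T = M :=
    comap_map_eq_self_of_injective T.subtype_injective M
  have hMidx : ¬ (p : ℕ) ∣ M.index := by
    refine hM.resolve_right fun hx => hMtop ?_
    have h1 : T ≤ M.map T.subtype := pResidual_le_of_pow_mem fun x hxT => by
      obtain ⟨k, hk⟩ := hx ⟨x, hxT⟩
      exact ⟨k, _, hk, rfl⟩
    rw [← hMT, subgroupOf_eq_top]
    exact h1
  have hcard : ¬ (p : ℕ) ∣ Nat.card T := by
    refine not_dvd_card_pResidual_residual hF hS hV ⟨M.map T.subtype, ?_, ?_, ?_, ?_⟩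
    · refine lt_of_le_of_ne (map_subtype_le M) fun he => hMtop ?_
      rw [← hMT, subgroupOf_eq_top]
      exact he.ge
    · rw [inf_comm, ← subgroupOf_map_subtype]
      exact map_mono hDM
    · rwa [hMT]
    · rwa [relIndex, hMT]
  rw [← card_map_of_injective U.subtype_injective, hTmap] at hcard
  set T' := pResidual p (F.residualIn U) with hT'
  have hconj : ∀ l ∈ L, ∀ t ∈ T', l * t * l⁻¹ ∈ T' := fun l hl t ht =>
    conj_mem_pResidual (fun y hy => (mem_normalizer_iff.1 (hnorm U hl) y).1 hy) ht
  have hB : L ⊓ T' = ⊥ := by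
    refine eq_bot_of_isChiefFactor_of_not_dvd hL p hp inf_le_left ⟨fun x hx l => ?_⟩
      fun hd => hcard (hd.trans (card_dvd_of_le inf_le_right))
    exact ⟨hLn.conj_mem x hx.1 l, hconj l l.2 x hx.2⟩
  refine hU fun t ht => mem_centralizer_iff.2 fun l hl => ?_
  have h1 : l * t * l⁻¹ * t⁻¹ ∈ L ⊓ T' := by
    refine mem_inf.2 ⟨?_, mul_mem (hconj l hl t ht) (inv_mem ht)⟩
    rw [mul_assoc, mul_assoc, ← mul_assoc t]
    exact mul_mem hl (hLn.conj_mem _ (inv_mem hl) t)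
  rw [hB, mem_bot, mul_inv_eq_one, mul_inv_eq_iff_eq_mul] at h1
  exact h1

theorem residual_le_centralizer {F : GroupClass.{u}} (hF : F.IsFormation)
    (hS : F.IsSubgroupClosed) {π : Set Nat.Primes} {p : Nat.Primes} (hpπ : p ∈ π) {G : Type u}
    [Group G] [Finite G]
    (h : (formationProduct (piSolvableGroups π) F).Mem G ∨ BoundaryConditionII π F)
    {L : Subgroup G} (hL : IsChiefFactor ⊥ L) (hp : (p : ℕ) ∣ Nat.card L)
    (hnorm : ∀ U : Subgroup G, L ≤ normalizer (F.residualIn U : Set G)) :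
    ⁅L, F.residual G⁆ = ⊥ := by
  have hpp : Fact (p : ℕ).Prime := ⟨p.2⟩
  have hLn := hL.normal_top
  have hC := pResidual_residual_le_centralizer hF hS hpπ h hL hp hnorm
  set R := F.residual G with hR
  set ρ : R →* MulAut L := (MulAut.conjNormal (H := L)).comp R.subtype with hρ
  have hρp : IsPGroup p ρ.range := by
    rintro ⟨_, x, rfl⟩
    obtain ⟨k, hk⟩ := exists_pow_mem_pResidual (p := p) x.2
    refine ⟨k, Subtype.ext ?_⟩
    change ρ x ^ (p : ℕ) ^ k = 1
    rw [← map_pow]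
    refine MulEquiv.ext fun l => Subtype.ext ?_
    have h1 := mem_centralizer_iff.1 (hC hk) l l.2
    simp only [hρ, MonoidHom.comp_apply, subtype_apply, MulAut.conjNormal_apply, MulAut.one_apply]
    push_cast
    rw [← h1, mul_inv_cancel_right]
  -- A `p`-group acting on a set of size divisible by `p` and fixing `1` fixes another point, so
  -- `C_L(R) ≠ 1`.
  have h1 : (1 : L) ∈ MulAction.fixedPoints ρ.range L := fun g => map_one (g : MulAut L)
  obtain ⟨b, hb, hne⟩ := hρp.exists_fixed_point_of_prime_dvd_card_of_fixed_point L hp h1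
  have hbC : (b : G) ∈ L ⊓ centralizer (R : Set G) := by
    refine ⟨b.2, mem_centralizer_iff.2 fun x hx => ?_⟩
    have h2 : ρ ⟨x, hx⟩ b = b := hb ⟨ρ ⟨x, hx⟩, _, rfl⟩
    have h3 : x * b * x⁻¹ = b := congr_arg Subtype.val h2
    exact mul_inv_eq_iff_eq_mul.1 h3
  rcases hL.eq_or_eq (L ⊓ centralizer (R : Set G)) inferInstance bot_le inf_le_left with h2 | h2
  · rw [h2, mem_bot] at hbC
    exact absurd (Subtype.ext hbC.symm) hne
  · rw [commutator_eq_bot_iff_le_centralizer]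
    exact inf_eq_left.1 h2

end GroupClass

namespace Subgroup

theorem eq_bot_of_commutator_eq_self {X : Type*} [Group X] {N W : Subgroup X}
    (hW : Group.IsNilpotent W) (hNW : N ≤ W) (h : ⁅N, W⁆ = N) : N = ⊥ := by
  obtain ⟨n, hn⟩ := (isNilpotent_iff_lowerCentralSeries W).1 hW
  have hle : ∀ n : ℕ, N ≤ W.lowerCentralSeries n := by
    intro n
    induction n with
    | zero => exact hNW
    | succ n ih =>
      rw [lowerCentralSeries_succ, ← h]
      exact commutator_mono ih le_rfl
  exact le_bot_iff.1 (hn ▸ hle n)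

end Subgroup

/-! ### Chief factors central for `N∘F` -/

namespace GroupClass

variable {F : GroupClass.{u}}

section Semidirect

variable {A Q : Type u} [Group A] [Group Q] {φ : Q →* MulAut A}

/-- The maps `(a, q) ↦ q` and `(a, q) ↦ ι a * q` are onto `Q` with trivially intersecting kernels,
so the product is subdirect in `Q × Q`. -/
theorem IsFormation.mem_semidirectProduct (hF : F.IsFormation) {ι : A →* Q}
    (hι : Function.Injective ι) (hφι : ∀ q a, ι (φ q a) = q * ι a * q⁻¹) (hQ : F.Mem Q) :
    F.Mem (SemidirectProduct A Q φ) := by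
  set f₁ : SemidirectProduct A Q φ →* Q := SemidirectProduct.rightHom with hf₁
  set f₂ : SemidirectProduct A Q φ →* Q := SemidirectProduct.lift ι (MonoidHom.id Q)
    (fun q => MonoidHom.ext fun a => hφι q a) with hf₂
  have hs₁ : Function.Surjective f₁ := SemidirectProduct.rightHom_surjective
  have hs₂ : Function.Surjective f₂ := fun q => ⟨SemidirectProduct.inr q, by simp [hf₂]⟩
  have h := hF.quotient_inf f₁.ker f₂.ker
    (F.of_equiv (QuotientGroup.quotientKerEquivOfSurjective f₁ hs₁).symm hQ)
    (F.of_equiv (QuotientGroup.quotientKerEquivOfSurjective f₂ hs₂).symm hQ)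
  have hbot : f₁.ker ⊓ f₂.ker = ⊥ := by
    rw [eq_bot_iff]
    rintro x ⟨h1, h2⟩
    have hr : x.right = 1 := h1
    have hl : ι x.left * x.right = 1 := h2
    rw [hr, mul_one, map_eq_one_iff ι hι] at hl
    exact SemidirectProduct.ext hl hr
  exact F.of_equiv ((QuotientGroup.quotientMulEquivOfEq hbot).trans QuotientGroup.quotientBot) h



theorem center_eq_bot_or_mul_comm_of_irreducible
    (hirr : ∀ B : Subgroup A, (∀ q, ∀ b ∈ B, φ q b ∈ B) → B = ⊥ ∨ B = ⊤) :
    center A = ⊥ ∨ ∀ a b : A, a * b = b * a := by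
  refine (hirr (center A) fun q b hb => ?_).imp_right fun h a b => ?_
  · have h1 : (center A).map (φ q).toMonoidHom ≤ center A :=
      characteristic_iff_map_le.1 inferInstance (φ q)
    exact h1 ⟨b, hb, rfl⟩
  · exact (mem_center_iff.1 (h ▸ mem_top b : b ∈ center A) a)

theorem mul_comm_of_irreducible_of_isNilpotent
    (hirr : ∀ B : Subgroup A, (∀ q, ∀ b ∈ B, φ q b ∈ B) → B = ⊥ ∨ B = ⊤)
    (hA : Group.IsNilpotent A) (a b : A) : a * b = b * a := by
  rcases center_eq_bot_or_mul_comm_of_irreducible hirr with h | h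
  · rcases subsingleton_or_nontrivial A with hA' | hA'
    · exact Subsingleton.elim _ _
    · exact absurd h (Group.IsNilpotent.center_ne_bot A)
  · exact h a b

/-- Irreducibility and nilpotency of the residual `W` force `[A, W] = 1`. It then suffices that `W ≤
A`, since `W` projects onto `Q^F`. -/
theorem IsFormation.mem_of_nilpotent_residual_semidirectProduct (hF : F.IsFormation) [Finite A]
    [Finite Q] (hφ : Function.Injective φ)
    (hirr : ∀ B : Subgroup A, (∀ q, ∀ b ∈ B, φ q b ∈ B) → B = ⊥ ∨ B = ⊤)
    (h : (formationProduct nilpotentGroups F).Mem (SemidirectProduct A Q φ)) : F.Mem Q := by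
  have hfin := h.1
  have hnil := h.2.2
  set W := F.residual (SemidirectProduct A Q φ) with hW
  have hWn : W.Normal := F.residual_normal _
  set N : Subgroup (SemidirectProduct A Q φ) := (SemidirectProduct.inl (φ := φ)).range with hN
  have hNn : N.Normal := by
    rw [hN, SemidirectProduct.range_inl_eq_ker_rightHom]; infer_instance
  have hconj : ∀ (M : Subgroup (SemidirectProduct A Q φ)) [M.Normal], ∀ q, ∀ b ∈
      M.comap (SemidirectProduct.inl (φ := φ)), φ q b ∈ M.comap (SemidirectProduct.inl (φ := φ)) := by
    intro M hM q b hb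
    rw [mem_comap, SemidirectProduct.inl_aut, map_inv]
    exact hM.conj_mem _ hb _
  have hNW : ⁅N, W⁆ = ⊥ := by
    rcases hirr (⁅N, W⁆.comap SemidirectProduct.inl) (hconj _) with h1 | h1
    · rw [eq_bot_iff]
      intro x hx
      obtain ⟨a, rfl⟩ : x ∈ N := commutator_le_left N W hx
      rw [← mem_comap, h1, mem_bot] at hx
      rw [hx, map_one]
      exact one_mem _
    · have h2 : N ≤ ⁅N, W⁆ := by
        rintro _ ⟨a, rfl⟩
        exact h1.ge (mem_top a)
      have h3 : N = ⊥ := eq_bot_of_commutator_eq_self hnil (h2.trans (commutator_le_right N W))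
        (le_antisymm (commutator_le_left N W) h2)
      rw [h3, commutator_bot_left]
  have hact : ∀ w ∈ W, ∀ b : A, w.left * φ w.right b = b * w.left := by
    intro w hw b
    have h1 := mem_centralizer_iff.1 ((commutator_eq_bot_iff_le_centralizer.1 hNW) ⟨b, rfl⟩) w hw
    have h2 := congr_arg SemidirectProduct.left h1
    simpa using h2
  -- As `w = (a, q)` centralises `A`, `q` acts as conjugation by `a⁻¹`. The image of `θ` is
  -- invariant: if trivial, `q` acts trivially; if all of `A`, then `A` is nilpotent, hence abelian,
  -- and again `q` acts trivially.
  set θ : W →* A :=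
    { toFun := fun w => (w : SemidirectProduct A Q φ).left⁻¹
      map_one' := by simp
      map_mul' := fun v w => by
        rw [coe_mul, SemidirectProduct.mul_left, hact v v.2, mul_inv_rev] } with hθ
  have hright : ∀ w ∈ W, w.right = 1 := by
    have hcomm : (∀ a b : A, a * b = b * a) → ∀ w ∈ W, w.right = 1 := by
      intro hc w hw
      refine (map_eq_one_iff φ hφ).1 (MulEquiv.ext fun b => ?_)
      have h1 := hact w hw b
      rw [hc b] at h1
      exact mul_left_cancel h1
    have hθ_inv : ∀ q, ∀ b ∈ θ.range, φ q b ∈ θ.range := by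
      rintro q _ ⟨w, rfl⟩
      refine ⟨⟨_, hWn.conj_mem w w.2 (SemidirectProduct.inr q)⟩, ?_⟩
      simp [hθ]
    rcases hirr θ.range hθ_inv with h1 | h1
    · intro w hw
      have h2 : w.left⁻¹ = 1 := mem_bot.1 (h1 ▸ (⟨⟨w, hw⟩, rfl⟩ : w.left⁻¹ ∈ θ.range))
      refine (map_eq_one_iff φ hφ).1 (MulEquiv.ext fun b => ?_)
      have h3 := hact w hw b
      rw [inv_eq_one.1 h2] at h3
      simpa using h3
    · exact hcomm (mul_comm_of_irreducible_of_isNilpotent hirr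
        (Group.nilpotent_of_surjective θ (MonoidHom.range_eq_top.1 h1)))
  have hres : F.residual Q = ⊥ := by
    rw [← hF.residual_map_of_surjective _ (SemidirectProduct.rightHom_surjective (φ := φ)),
      eq_bot_iff]
    rintro _ ⟨w, hw, rfl⟩
    exact hright w hw
  exact F.of_equiv QuotientGroup.quotientBot (hF.mem_quotient_of_residual_le ⊥ hres.le)

/-- If `Z(A) = 1`, then `ι` is injective and the product lies in `F`. Otherwise `A` is abelian and
contains the residual. -/
theorem IsFormation.nilpotent_residual_semidirectProduct_of_mem (hF : F.IsFormation) [Finite A]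
    [Finite Q] (hirr : ∀ B : Subgroup A, (∀ q, ∀ b ∈ B, φ q b ∈ B) → B = ⊥ ∨ B = ⊤)
    {ι : A →* Q} (hιφ : ∀ a b, φ (ι a) b = a * b * a⁻¹)
    (hφι : ∀ q a, ι (φ q a) = q * ι a * q⁻¹) (hQ : F.Mem Q) :
    (formationProduct nilpotentGroups F).Mem (SemidirectProduct A Q φ) := by
  have hfin : Finite (SemidirectProduct A Q φ) :=
    Finite.of_equiv _ SemidirectProduct.equivProd.symm
  refine ⟨hfin, inferInstance, ?_⟩
  rcases center_eq_bot_or_mul_comm_of_irreducible hirr with h | h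
  · have hι : Function.Injective ι := by
      rw [injective_iff_map_eq_one]
      intro a ha
      rw [← mem_bot, ← h, mem_center_iff]
      intro b
      have h1 := hιφ a b
      rw [ha, map_one, MulAut.one_apply, eq_mul_inv_iff_mul_eq] at h1
      exact h1
    rw [residual_eq_bot_of_mem (hF.mem_semidirectProduct hι hφι hQ)]
    infer_instance
  · have h1 := residual_le_ker (F := F) (SemidirectProduct.rightHom (φ := φ))
      SemidirectProduct.rightHom_surjective hQ
    have h2 : ∀ x y : F.residual (SemidirectProduct A Q φ), x * y = y * x := by
      intro x y
      have hx : (x : SemidirectProduct A Q φ).right = 1 := h1 x.2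
      have hy : (y : SemidirectProduct A Q φ).right = 1 := h1 y.2
      refine Subtype.ext (SemidirectProduct.ext ?_ ?_)
      · simp [hx, hy, h]
      · simp [hx, hy]
    exact @CommGroup.isNilpotent _ { (inferInstance : Group _) with mul_comm := h2 }

end Semidirect

section ChiefFactor

variable {G : Type u} [Group G] {K L : Subgroup G}

theorem mem_ker_factorAction_iff [hK : K.Normal] [hL : L.Normal] {x : G} :
    x ∈ (factorAction K L).ker ↔ ∀ l ∈ L, ⁅l, x⁆ ∈ K := by
  have key : ∀ l : G, (QuotientGroup.mk' K x * QuotientGroup.mk' K l * (QuotientGroup.mk' K x)⁻¹ =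
      QuotientGroup.mk' K l) ↔ ⁅l, x⁆ ∈ K := by
    intro l
    rw [mul_inv_eq_iff_eq_mul, eq_comm, ← mul_inv_eq_one, mul_inv_rev, ← mul_assoc]
    exact QuotientGroup.eq_one_iff ⁅l, x⁆
  rw [MonoidHom.mem_ker]
  constructor
  · intro h l hl
    rw [← key]
    exact congr_arg Subtype.val (DFunLike.congr_fun h ⟨QuotientGroup.mk' K l, mem_map_of_mem _ hl⟩)
  · intro h
    refine MulEquiv.ext ?_
    rintro ⟨_, l, hl, rfl⟩
    exact Subtype.ext ((key l).2 (h l hl))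

theorem le_ker_factorAction_iff [hK : K.Normal] [hL : L.Normal] {R : Subgroup G} :
    R ≤ (factorAction K L).ker ↔ ⁅L, R⁆ ≤ K := by
  rw [commutator_le]
  exact ⟨fun h l hl x hx => mem_ker_factorAction_iff.1 (h hx) l hl,
    fun h x hx => mem_ker_factorAction_iff.2 fun l hl => h l hl x hx⟩

theorem coe_factorAction_apply [hK : K.Normal] [hL : L.Normal] (g : G) (a : factor K L) :
    (factorAction K L g a : G ⧸ K) = (g : G ⧸ K) * a * (g : G ⧸ K)⁻¹ :=
  rfl

theorem _root_.IsChiefFactor.eq_bot_or_eq_top (h : IsChiefFactor K L) [hK : K.Normal]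
    [hL : L.Normal] (B : Subgroup (factor K L))
    (hB : ∀ g, ∀ b ∈ B, factorAction K L g b ∈ B) : B = ⊥ ∨ B = ⊤ := by
  set M := (B.map (factor K L).subtype).comap (QuotientGroup.mk' K) with hM
  have hMn : M.Normal := by
    refine ⟨?_⟩
    rintro x ⟨b, hb, hbx⟩ g
    refine ⟨factorAction K L g b, hB g b hb, ?_⟩
    rw [subtype_apply, coe_factorAction_apply]
    simp only [subtype_apply] at hbx
    rw [hbx]
    simp
  have hmap : M.map (QuotientGroup.mk' K) = B.map (factor K L).subtype :=
    map_comap_eq_self_of_surjective (QuotientGroup.mk'_surjective K) _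
  have hKM : K ≤ M := by
    have := (QuotientGroup.mk' K).ker_le_comap (B.map (factor K L).subtype)
    rwa [QuotientGroup.ker_mk'] at this
  have hML : M ≤ L := by
    have h1 : M ≤ (factor K L).comap (QuotientGroup.mk' K) := comap_mono (map_subtype_le B)
    rwa [factor, comap_map_eq, QuotientGroup.ker_mk', sup_eq_left.2 h.lt.le] at h1
  refine (h.eq_or_eq M hMn hKM hML).imp (fun h1 => ?_) fun h1 => ?_
  · rw [h1, (Subgroup.map_eq_bot_iff K).2 (QuotientGroup.ker_mk' K).ge] at hmap
    rw [← comap_map_eq_self_of_injective (factor K L).subtype_injective B, ← hmap,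
      MonoidHom.comap_bot, ker_subtype]
  · rw [h1] at hmap
    rw [← comap_map_eq_self_of_injective (factor K L).subtype_injective B, ← hmap]
    exact subgroupOf_self _

theorem IsFormation.isCentralFactor_formationProduct_iff (hF : F.IsFormation) [Finite G]
    (h : IsChiefFactor K L) [hK : K.Normal] [hL : L.Normal] :
    (formationProduct nilpotentGroups F).IsCentralFactor K L ↔ ⁅L, F.residual G⁆ ≤ K := by
  set N := (factorAction K L).ker with hN
  have hirr : ∀ B : Subgroup (factor K L), (∀ q, ∀ b ∈ B,
      QuotientGroup.kerLift (factorAction K L) q b ∈ B) → B = ⊥ ∨ B = ⊤ :=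
    fun B hB => h.eq_bot_or_eq_top B fun g b hb => hB (g : G ⧸ N) b hb
  have hiff : F.Mem (G ⧸ N) ↔ ⁅L, F.residual G⁆ ≤ K := by
    rw [← le_ker_factorAction_iff]
    exact ⟨fun h => residual_le _ h, fun h => hF.mem_quotient_of_residual_le _ h⟩
  rw [← hiff]
  have hKN : K ≤ N := fun x hx => mem_ker_factorAction_iff.2 fun l _ =>
    commutator_le_right ⊤ K (commutator_mem_commutator (mem_top l) hx)
  refine ⟨fun hc => hF.mem_of_nilpotent_residual_semidirectProduct
    (QuotientGroup.kerLift_injective _) hirr hc, fun hQ =>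
    hF.nilpotent_residual_semidirectProduct_of_mem hirr
      (ι := (QuotientGroup.map K N (MonoidHom.id G) hKN).comp (factor K L).subtype) ?_ ?_ hQ⟩
  · rintro ⟨_, l, hl, rfl⟩ b
    exact Subtype.ext rfl
  · rintro q ⟨_, l, hl, rfl⟩
    obtain ⟨g, rfl⟩ := QuotientGroup.mk_surjective q
    rfl

end ChiefFactor
end GroupClass

theorem Subgroup.commutator_le_of_eq_sup {G : Type*} [Group G] {A B C R : Subgroup G}
    [hA : A.Normal] (hB : B = A ⊔ C) (h : ⁅C, R⁆ ≤ A) : ⁅B, R⁆ ≤ A := by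
  have hker := QuotientGroup.ker_mk' A
  have h1 : ⁅C, R⁆.map (QuotientGroup.mk' A) = ⊥ :=
    (Subgroup.map_eq_bot_iff _).2 (h.trans hker.ge)
  have h2 : ⁅B, R⁆.map (QuotientGroup.mk' A) = ⊥ := by
    rw [map_commutator, hB, Subgroup.map_sup, (Subgroup.map_eq_bot_iff A).2 hker.ge, bot_sup_eq,
      ← map_commutator, h1]
  exact ((Subgroup.map_eq_bot_iff _).1 h2).trans hker.le

/-! ### Chief factors under epimorphisms -/

section Transfer

variable {G H : Type u} [Group G] [Group H] {f : G →* H}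

theorem IsChiefFactor.comap_of_surjective (hf : Function.Surjective f) {K L : Subgroup H}
    (h : IsChiefFactor K L) : IsChiefFactor (K.comap f) (L.comap f) where
  normal_bot := h.normal_bot.comap f
  normal_top := h.normal_top.comap f
  lt := (comap_lt_comap_of_surjective hf).2 h.lt
  eq_or_eq M hM h1 h2 := by
    have hM' : (M.map f).comap f = M :=
      comap_map_eq_self ((f.ker_le_comap K).trans h1)
    have hK := map_comap_eq_self_of_surjective hf K
    have hL := map_comap_eq_self_of_surjective hf L
    refine (h.eq_or_eq (M.map f) (hM.map f hf) (hK ▸ map_mono h1) (hL ▸ map_mono h2)).imp ?_ ?_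
    · intro h3; rw [← h3, hM']
    · intro h3; rw [← h3, hM']

theorem mem_of_map_mem_of_inf_ker_le {K L : Subgroup G} (hKL : K ≤ L) (hker : L ⊓ f.ker ≤ K) {x : G}
    (hx : x ∈ L) (h : f x ∈ K.map f) : x ∈ K := by
  obtain ⟨k, hk, hkx⟩ := h
  have h1 : k⁻¹ * x ∈ K := hker (mem_inf.2 ⟨mul_mem (inv_mem (hKL hk)) hx, by
    rw [MonoidHom.mem_ker, map_mul, map_inv, hkx, inv_mul_cancel]⟩)
  simpa using mul_mem hk h1

theorem IsChiefFactor.map_of_inf_ker_le (hf : Function.Surjective f) {K L : Subgroup G}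
    (h : IsChiefFactor K L) (hker : L ⊓ f.ker ≤ K) : IsChiefFactor (K.map f) (L.map f) where
  normal_bot := h.normal_bot.map f hf
  normal_top := h.normal_top.map f hf
  lt := lt_of_le_not_ge (map_mono h.lt.le) fun hle => h.lt.not_ge fun _ hx =>
    mem_of_map_mem_of_inf_ker_le h.lt.le hker hx (hle (mem_map_of_mem f hx))
  eq_or_eq M hM h1 h2 := by
    have hLn := h.normal_top
    have hM' : M = (M.comap f ⊓ L).map f := by
      apply le_antisymm
      · intro y hy
        obtain ⟨l, hl, rfl⟩ := h2 hy
        exact ⟨l, mem_inf.2 ⟨hy, hl⟩, rfl⟩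
      · rw [map_le_iff_le_comap]
        exact inf_le_left
    rw [hM']
    exact (h.eq_or_eq (M.comap f ⊓ L) inferInstance (le_inf (map_le_iff_le_comap.1 h1) h.lt.le)
      inf_le_right).imp (fun h3 => by rw [h3]) fun h3 => by rw [h3]

theorem dvd_relIndex_map_of_inf_ker_le [Finite G] (hf : Function.Surjective f) {K L : Subgroup G}
    (hK : K.Normal) (hKL : K ≤ L) (hker : L ⊓ f.ker ≤ K) {p : ℕ} [Fact p.Prime]
    (hp : p ∣ K.relIndex L) : p ∣ (K.map f).relIndex (L.map f) := by
  obtain ⟨x, hx, hxK, k, hk⟩ := exists_pow_eq_one_of_dvd_relIndex hp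
  have hKn : (K.map f).Normal := hK.map f hf
  refine dvd_relIndex_of_pow_eq_one (k := k) (mem_map_of_mem f hx)
    (fun h => hxK (mem_of_map_mem_of_inf_ker_le hKL hker hx h)) ?_
  rw [← map_pow, hk, map_one]

theorem commutator_le_of_map_of_inf_ker_le {K L R : Subgroup G} (hL : L.Normal) (hKL : K ≤ L)
    (hker : L ⊓ f.ker ≤ K) (h : ⁅L.map f, R.map f⁆ ≤ K.map f) : ⁅L, R⁆ ≤ K := by
  intro x hx
  refine mem_of_map_mem_of_inf_ker_le hKL hker (commutator_le_left L R hx) (h ?_)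
  rw [← map_commutator]
  exact mem_map_of_mem f hx

end Transfer

/-! ### The hypercentre relative to a subgroup -/

/-- Every chief factor of `G` below `N` with order divisible by a prime in `π` is centralised
by `R`. -/
def IsPiCentralizedBy (π : Set Nat.Primes) {G : Type u} [Group G] (R N : Subgroup G) : Prop :=
  ∀ K L : Subgroup G, IsChiefFactor K L → L ≤ N → (∃ p ∈ π, (p : ℕ) ∣ K.relIndex L) → ⁅L, R⁆ ≤ K

/-- The largest normal subgroup of `G` whose chief factors with order divisible by a prime in `π`
are centralised by `R`. -/
def relHypercentre (π : Set Nat.Primes) {G : Type u} [Group G] (R : Subgroup G) : Subgroup G :=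
  sSup {N | N.Normal ∧ IsPiCentralizedBy π R N}

namespace IsPiCentralizedBy

variable {π : Set Nat.Primes} {G H : Type u} [Group G] [Group H] [Finite G] {R N : Subgroup G}

/-- Stands in for a Jordan–Hölder argument: a chief factor `B/A` of `S` that meets `N` is covered by
one chief factor `L/M` of `G` below `N`, with `L` minimal such that `B ∩ L` is not in `A`.
Centrality of `L/M` then descends to `B/A`. -/
theorem commutator_comap_le {S : Type u} [Group S] {σ : S →* G} (hσ : Function.Injective σ)
    (hN : N.Normal) (h : IsPiCentralizedBy π R N) {A B : Subgroup S} (hAB : IsChiefFactor A B)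
    (hne : ¬ B ⊓ N.comap σ ≤ A) {p : Nat.Primes} (hpπ : p ∈ π) (hp : (p : ℕ) ∣ A.relIndex B) :
    ⁅B, R.comap σ⁆ ≤ A := by
  have hfin : Finite S := Finite.of_injective σ hσ
  have hpp : Fact (p : ℕ).Prime := ⟨p.2⟩
  have hA := hAB.normal_bot
  have hB := hAB.normal_top
  obtain ⟨L, ⟨hLn, hLN, hL⟩, hmin⟩ := wellFounded_lt.has_min
    {L : Subgroup G | L.Normal ∧ L ≤ N ∧ ¬ B ⊓ L.comap σ ≤ A} ⟨N, hN, le_rfl, hne⟩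
  have hLbot : ⊥ < L := by
    rw [bot_lt_iff_ne_bot]
    rintro rfl
    apply hL
    rw [MonoidHom.comap_bot, (MonoidHom.ker_eq_bot_iff σ).2 hσ, inf_bot_eq]
    exact bot_le
  obtain ⟨M, -, hM⟩ := exists_isChiefFactor_top inferInstance hLn hLbot
  have hBM : B ⊓ M.comap σ ≤ A := by
    by_contra hc
    exact hmin M ⟨hM.normal_bot, hM.lt.le.trans hLN, hc⟩ hM.lt
  have hsup : B = A ⊔ B ⊓ L.comap σ := by
    rcases hAB.eq_or_eq (A ⊔ B ⊓ L.comap σ) inferInstance le_sup_left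
      (sup_le hAB.lt.le inf_le_left) with h1 | h1
    · exact absurd (sup_eq_left.1 h1) hL
    · exact h1.symm
  have hdvd : (p : ℕ) ∣ M.relIndex L := by
    rw [hsup, relIndex_sup_left] at hp
    obtain ⟨x, hx, hxA, k, hk⟩ := exists_pow_eq_one_of_dvd_relIndex hp
    have hMn := hM.normal_bot
    refine dvd_relIndex_of_pow_eq_one (x := σ x) (k := k) hx.2 (fun hxM => hxA (hBM ?_)) ?_
    · exact mem_inf.2 ⟨hx.1, hxM⟩
    · rw [← map_pow, hk, map_one]
  have hcomm := h M L hM hLN ⟨p, hpπ, hdvd⟩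
  refine commutator_le_of_eq_sup hsup (le_trans (le_inf ?_ ?_) hBM)
  · exact (commutator_mono inf_le_left le_rfl).trans (commutator_le_left B _)
  · rw [commutator_le]
    intro x hx r hr
    rw [mem_comap, map_commutatorElement]
    exact hcomm (commutator_mem_commutator hx.2 hr)

theorem commutator_le (hN : N.Normal) (h : IsPiCentralizedBy π R N) {A B : Subgroup G}
    (hAB : IsChiefFactor A B) (hne : ¬ B ⊓ N ≤ A) {p : Nat.Primes} (hpπ : p ∈ π)
    (hp : (p : ℕ) ∣ A.relIndex B) : ⁅B, R⁆ ≤ A :=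
  h.commutator_comap_le (σ := MonoidHom.id G) Function.injective_id hN hAB hne hpπ hp

theorem map {f : G →* H} (hf : Function.Surjective f) (hN : N.Normal)
    (h : IsPiCentralizedBy π R N) : IsPiCentralizedBy π (R.map f) (N.map f) := by
  rintro K L hKL hLN ⟨p, hpπ, hp⟩
  have h1 : ⁅L.comap f, R⁆ ≤ K.comap f := by
    refine h.commutator_le hN (hKL.comap_of_surjective hf) (fun hle => hKL.lt.not_ge ?_) hpπ ?_
    · intro y hy
      obtain ⟨x, hx, rfl⟩ := hLN hy
      exact hle (mem_inf.2 ⟨hy, hx⟩)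
    · rwa [relIndex_comap, map_comap_eq_self_of_surjective hf]
  rw [← map_comap_eq_self_of_surjective hf L, ← map_commutator, map_le_iff_le_comap]
  exact h1

/-- A chief factor either survives under `f` or meets `f.ker` nontrivially; in the latter case
`hker` decides. -/
theorem comap {f : G →* H} (hf : Function.Surjective f) (hker : IsPiCentralizedBy π R f.ker)
    {N : Subgroup H} (h : IsPiCentralizedBy π (R.map f) N) : IsPiCentralizedBy π R (N.comap f) := by
  rintro K L hKL hLN ⟨p, hpπ, hp⟩
  have hpp : Fact (p : ℕ).Prime := ⟨p.2⟩
  by_cases hle : L ⊓ f.ker ≤ K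
  · exact commutator_le_of_map_of_inf_ker_le hKL.normal_top hKL.lt.le hle
      (h _ _ (hKL.map_of_inf_ker_le hf hle) (map_le_iff_le_comap.2 hLN)
        ⟨p, hpπ, dvd_relIndex_map_of_inf_ker_le hf hKL.normal_bot hKL.lt.le hle hp⟩)
  · exact hker.commutator_le inferInstance hKL hle hpπ hp

theorem sup {N₁ N₂ : Subgroup G} (hN₁ : N₁.Normal) (hN₂ : N₂.Normal)
    (h₁ : IsPiCentralizedBy π R N₁) (h₂ : IsPiCentralizedBy π R N₂) :
    IsPiCentralizedBy π R (N₁ ⊔ N₂) := by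
  have hs := QuotientGroup.mk'_surjective N₁
  have hker := QuotientGroup.ker_mk' N₁
  have h3 := comap hs (by rwa [hker]) (h₂.map hs hN₂)
  rwa [comap_map_eq, hker, sup_comm] at h3

end IsPiCentralizedBy

section relHypercentre

theorem le_relHypercentre {π : Set Nat.Primes} {G : Type u} [Group G] {R N : Subgroup G}
    (hN : N.Normal) (h : IsPiCentralizedBy π R N) : N ≤ relHypercentre π R :=
  le_sSup ⟨hN, h⟩

variable {π : Set Nat.Primes} {G H : Type u} [Group G] [Group H] [Finite G] {R : Subgroup G}

theorem relHypercentre_spec (π : Set Nat.Primes) (R : Subgroup G) :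
    (relHypercentre π R).Normal ∧ IsPiCentralizedBy π R (relHypercentre π R) := by
  have hsup : SupClosed {N : Subgroup G | N.Normal ∧ IsPiCentralizedBy π R N} := by
    rintro M ⟨hM, h1⟩ N ⟨hN, h2⟩
    exact ⟨inferInstance, h1.sup hM hN h2⟩
  exact hsup.sSup_mem (Set.toFinite _)
    ⟨inferInstance, fun K L h hL _ => absurd h.lt (not_lt_of_ge (hL.trans bot_le))⟩ subset_rfl

instance relHypercentre_normal : (relHypercentre π R).Normal :=
  (relHypercentre_spec π R).1

theorem isPiCentralizedBy_relHypercentre : IsPiCentralizedBy π R (relHypercentre π R) :=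
  (relHypercentre_spec π R).2

theorem relHypercentre_map_le {f : G →* H} (hf : Function.Surjective f) :
    (relHypercentre π R).map f ≤ relHypercentre π (R.map f) :=
  le_sSup ⟨relHypercentre_normal.map f hf, isPiCentralizedBy_relHypercentre.map hf inferInstance⟩

theorem relHypercentre_map {f : G →* H} (hf : Function.Surjective f)
    (hker : f.ker ≤ relHypercentre π R) :
    (relHypercentre π R).map f = relHypercentre π (R.map f) := by
  have : Finite H := Finite.of_surjective f hf
  refine le_antisymm (relHypercentre_map_le hf) ?_
  rw [← map_comap_eq_self_of_surjective hf (relHypercentre π (R.map f))]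
  refine map_mono (le_relHypercentre inferInstance ?_)
  exact IsPiCentralizedBy.comap hf (fun K L h hL => isPiCentralizedBy_relHypercentre K L h
    (hL.trans hker)) isPiCentralizedBy_relHypercentre

instance relHypercentre_top_characteristic : (relHypercentre π (⊤ : Subgroup G)).Characteristic :=
  characteristic_iff_map_le.2 fun e => by
    have h := relHypercentre_map_le (π := π) (R := (⊤ : Subgroup G)) (f := e.toMonoidHom)
      e.surjective
    rwa [map_top_of_surjective e.toMonoidHom e.surjective] at h

/-- Refine a chief factor `L/M` of `G` at the top by a chief factor `L/M₀` of `R`. Then `[L, R] ≤ M₀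
< L`, and `M [L, R]` is normal in `G`, so it equals `M`. -/
theorem isPiCentralizedBy_relHypercentre_top_map [hR : R.Normal] :
    IsPiCentralizedBy π R ((relHypercentre π (⊤ : Subgroup R)).map R.subtype) := by
  rintro M L hML hL ⟨p, hpπ, hp⟩
  have hpp : Fact (p : ℕ).Prime := ⟨p.2⟩
  have hMn := hML.normal_bot
  have hLn := hML.normal_top
  have hLR : L ≤ R := hL.trans (map_subtype_le _)
  have hmap : (L.subgroupOf R).map R.subtype = L := by
    rw [subgroupOf_map_subtype, inf_eq_left.2 hLR]
  have hlt : M.subgroupOf R < L.subgroupOf R := by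
    rw [← map_subtype_lt_map_subtype, hmap, subgroupOf_map_subtype,
      inf_eq_left.2 (hML.lt.le.trans hLR)]
    exact hML.lt
  obtain ⟨M₀, hMM₀, hM₀⟩ := exists_isChiefFactor_top inferInstance inferInstance hlt
  have hlt' : M₀.map R.subtype < L := by
    rw [← hmap, map_subtype_lt_map_subtype]
    exact hM₀.lt
  have hMM₀' : M ≤ M₀.map R.subtype := by
    rw [← inf_eq_left.2 (hML.lt.le.trans hLR), ← subgroupOf_map_subtype]
    exact map_mono hMM₀
  -- Otherwise `M₀` contains the `G`-normal subgroup generated by the `p`-elements of `L`, which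
  -- together with `M` generates `L`.
  have hdvd : (p : ℕ) ∣ M₀.relIndex (L.subgroupOf R) := by
    by_contra hnd
    have hCn := closure_pow_eq_one_normal p L
    have hle : closure {x | x ∈ L ∧ ∃ k : ℕ, x ^ (p : ℕ) ^ k = 1} ≤ M₀.map R.subtype := by
      rw [closure_le]
      rintro x ⟨hx, k, hk⟩
      by_contra hxM
      have hM₀n := hM₀.normal_bot
      refine hnd (dvd_relIndex_of_pow_eq_one (x := ⟨x, hLR hx⟩) (k := k) hx
        (fun h => hxM ⟨_, h, rfl⟩) (Subtype.ext hk))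
    obtain ⟨x, hx, hxM, hk⟩ := exists_pow_eq_one_of_dvd_relIndex hp
    rcases hML.eq_or_eq (M ⊔ closure {x | x ∈ L ∧ ∃ k : ℕ, x ^ (p : ℕ) ^ k = 1}) inferInstance
      le_sup_left (sup_le hML.lt.le (hle.trans hlt'.le)) with h | h
    · exact hxM (h ▸ mem_sup_right (subset_closure ⟨hx, hk⟩))
    · exact hlt'.not_ge (h ▸ sup_le hMM₀' hle)
  have hcomm : ⁅L.subgroupOf R, ⊤⁆ ≤ M₀ := by
    refine isPiCentralizedBy_relHypercentre (π := π) _ _ hM₀ ?_ ⟨p, hpπ, hdvd⟩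
    rw [← map_subtype_le_map_subtype, hmap]
    exact hL
  have hcomm' : ⁅L, R⁆ ≤ M₀.map R.subtype := by
    have h := map_mono (f := R.subtype) hcomm
    rwa [map_commutator, hmap, ← MonoidHom.range_eq_map, range_subtype] at h
  rcases hML.eq_or_eq (M ⊔ ⁅L, R⁆) inferInstance le_sup_left
    (sup_le hML.lt.le (commutator_le_left L R)) with h | h
  · exact sup_eq_left.1 h
  · exact absurd (h ▸ sup_le hMM₀' hcomm') hlt'.not_ge

theorem relHypercentre_top_map_eq [hR : R.Normal] :
    (relHypercentre π (⊤ : Subgroup R)).map R.subtype = relHypercentre π R ⊓ R := by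
  apply le_antisymm
  · exact le_inf (le_relHypercentre inferInstance isPiCentralizedBy_relHypercentre_top_map)
      (map_subtype_le _)
  · rw [← subgroupOf_map_subtype]
    refine map_mono (le_relHypercentre inferInstance ?_)
    rintro A B hAB hB ⟨p, hpπ, hp⟩
    have h := isPiCentralizedBy_relHypercentre (R := R).commutator_comap_le R.subtype_injective
      inferInstance hAB (fun h => hAB.lt.not_ge ?_) hpπ hp
    · rwa [show R.comap R.subtype = ⊤ from subgroupOf_self R] at h
    · exact fun x hx => h (mem_inf.2 ⟨hx, hB hx⟩)

end relHypercentre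

/-! ### Hypercentres and the norm series as relative hypercentres -/

namespace GroupClass

variable {F : GroupClass.{u}} {π : Set Nat.Primes}

theorem IsFormation.isHypercentral_formationProduct_iff (hF : F.IsFormation) {G : Type u} [Group G]
    [Finite G] {N : Subgroup G} :
    IsHypercentral π (formationProduct nilpotentGroups F) N ↔
      IsPiCentralizedBy π (F.residual G) N := by
  refine forall₃_congr fun K L h => forall₂_congr fun _ _ => ?_
  have := h.normal_bot
  have := h.normal_top
  exact hF.isCentralFactor_formationProduct_iff h

theorem IsFormation.hypercentre_formationProduct_eq (hF : F.IsFormation) (π : Set Nat.Primes)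
    (G : Type u) [Group G] [Finite G] :
    hypercentre π (formationProduct nilpotentGroups F) G = relHypercentre π (F.residual G) := by
  simp only [hypercentre, relHypercentre, hF.isHypercentral_formationProduct_iff]

/-- The class of trivial groups. -/
def trivialGroups : GroupClass.{u} where
  Mem G _ := Subsingleton G
  finite h := @Finite.of_subsingleton _ h
  of_equiv e h := @Equiv.subsingleton _ _ e.symm.toEquiv h

theorem isFormation_trivialGroups : trivialGroups.{u}.IsFormation where
  nonempty := ⟨PUnit, inferInstance, (inferInstance : Subsingleton PUnit)⟩
  of_surjective _ hf h := by
    have : Subsingleton _ := h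
    exact hf.subsingleton
  quotient_inf M N _ _ h1 h2 := by
    have hM : M = ⊤ := QuotientGroup.subsingleton_iff.1 h1
    have hN : N = ⊤ := QuotientGroup.subsingleton_iff.1 h2
    subst hM hN
    exact QuotientGroup.subsingleton_iff.2 (inf_idem _)

theorem residual_trivialGroups (G : Type u) [Group G] : trivialGroups.residual G = ⊤ := by
  rw [eq_top_iff]
  refine le_sInf ?_
  rintro N ⟨_, hN⟩
  exact (QuotientGroup.subsingleton_iff.1 hN).ge

theorem formationProduct_trivialGroups_mem_iff (X : GroupClass.{u}) {G : Type u} [Group G] :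
    (formationProduct X trivialGroups).Mem G ↔ X.Mem G := by
  have h : X.Mem (trivialGroups.residual G) ↔ X.Mem G := by
    rw [residual_trivialGroups]
    exact ⟨X.of_equiv topEquiv, X.of_equiv topEquiv.symm⟩
  exact ⟨fun h1 => h.1 h1.2, fun h1 => ⟨X.finite h1, h.2 h1⟩⟩

theorem hypercentre_nilpotentGroups_eq (π : Set Nat.Primes) (G : Type u) [Group G] [Finite G] :
    hypercentre π nilpotentGroups G = relHypercentre π (⊤ : Subgroup G) := by
  rw [← residual_trivialGroups G, ← isFormation_trivialGroups.hypercentre_formationProduct_eq π G]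
  simp only [hypercentre, IsHypercentral, IsCentralFactor, formationProduct_trivialGroups_mem_iff]

theorem residualHypercentre_eq (π : Set Nat.Primes) (F : GroupClass.{u}) (G : Type u) [Group G]
    [Finite G] : residualHypercentre π F G = relHypercentre π (F.residual G) ⊓ F.residual G := by
  rw [residualHypercentre, hypercentre_nilpotentGroups_eq, relHypercentre_top_map_eq]

/-! ### Norms -/

theorem radical_le_norm (X F : GroupClass.{u}) (G : Type u) [Group G] :
    X.radical G ≤ X.norm F G :=
  le_iInf fun _ => le_sup_right.trans le_normalizer

theorem mem_normalizer_residualIn_sup_radical {X : GroupClass.{u}} {G : Type u} [Group G]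
    [Finite G] {H : Subgroup G} {x : G}
    (hx : ∀ a ∈ F.residualIn H, x * a * x⁻¹ ∈ F.residualIn H ⊔ X.radical G) :
    x ∈ normalizer ((F.residualIn H ⊔ X.radical G : Subgroup G) : Set G) := by
  refine mem_normalizer_fintype fun y hy => ?_
  obtain ⟨a, ha, o, ho, rfl⟩ := mem_sup_of_normal_right.1 hy
  have h1 : x * (a * o) * x⁻¹ = (x * a * x⁻¹) * (x * o * x⁻¹) := by group
  rw [h1]
  exact mul_mem (hx a ha) (mem_sup_right ((radical_normal X G).conj_mem o ho x))

theorem IsFormation.le_norm_of_commutator_eq_bot (hF : F.IsFormation) (hS : F.IsSubgroupClosed)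
    (X : GroupClass.{u}) {G : Type u} [Group G] [Finite G] {N : Subgroup G}
    (h : ⁅N, F.residual G⁆ = ⊥) : N ≤ X.norm F G := by
  refine le_iInf fun H x hx => mem_normalizer_residualIn_sup_radical fun a ha => ?_
  have h1 := mem_centralizer_iff.1 (commutator_eq_bot_iff_le_centralizer.1 h hx) a
    (hF.residualIn_le_residual hS H ha)
  rw [← h1, mul_inv_cancel_right]
  exact mem_sup_left ha

theorem IsFormation.norm_piGroups_map_le (hF : F.IsFormation) (π : Set Nat.Primes) {G H : Type u}
    [Group G] [Group H] [Finite G] {f : G →* H} (hf : Function.Surjective f) :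
    ((piGroups π).norm F G).map f ≤ (piGroups π).norm F H := by
  have : Finite H := Finite.of_surjective f hf
  rw [map_le_iff_le_comap]
  intro x hx
  rw [mem_comap]
  refine mem_iInf.2 fun U => mem_normalizer_residualIn_sup_radical fun a ha => ?_
  rw [← map_comap_eq_self_of_surjective hf U, ← hF.residualIn_map] at ha ⊢
  obtain ⟨b, hb, rfl⟩ := ha
  have h1 := (mem_normalizer_iff.1 (mem_iInf.1 hx (U.comap f)) b).1 (mem_sup_left hb)
  have h2 := mem_map_of_mem f h1
  rw [Subgroup.map_sup] at h2
  have h3 := sup_le_sup_left (piGroups_radical_map_le π f hf) _ h2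
  rw [map_mul, map_mul, map_inv] at h3
  exact h3

theorem piSolvableGroups_mem_of_surjective {G H : Type u} [Group G] [Group H] {f : G →* H}
    (hf : Function.Surjective f) (h : (piSolvableGroups π).Mem G) : (piSolvableGroups π).Mem H := by
  have := h.1
  refine ⟨Finite.of_surjective f hf, fun K L hKL => ?_⟩
  have h1 := h.2 _ _ (hKL.comap_of_surjective hf)
  rwa [relIndex_comap, map_comap_eq_self_of_surjective hf] at h1

theorem IsFormation.formationProduct_piSolvableGroups_mem_of_surjective (hF : F.IsFormation)
    {G H : Type u} [Group G] [Group H] {f : G →* H} (hf : Function.Surjective f)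
    (h : (formationProduct (piSolvableGroups π) F).Mem G) :
    (formationProduct (piSolvableGroups π) F).Mem H := by
  have := h.1
  have h1 := hF.residual_map_of_surjective f hf
  refine ⟨Finite.of_surjective f hf, ?_⟩
  rw [← h1]
  exact piSolvableGroups_mem_of_surjective (f.subgroupMap_surjective _) h.2

/-- For a chief factor `L/M` in the norm with `p ∣ |L/M|`, factor out `M` and then the `π'`-radical,
which `L/M` avoids. There the radical is trivial, so the norm normalises each `U^F` itself and
`residual_le_centralizer` applies. -/
theorem IsFormation.piNorm_le_relHypercentre (hF : F.IsFormation) (hS : F.IsSubgroupClosed)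
    {G : Type u} [Group G] [Finite G]
    (h : (formationProduct (piSolvableGroups π) F).Mem G ∨ BoundaryConditionII π F) :
    piNorm πᶜ F G ≤ relHypercentre π (F.residual G) := by
  refine le_relHypercentre inferInstance ?_
  rintro M L hML hL ⟨p, hpπ, hp⟩
  have hpp : Fact (p : ℕ).Prime := ⟨p.2⟩
  have hMn := hML.normal_bot
  have hLn := hML.normal_top
  set f₁ := QuotientGroup.mk' M with hf₁
  have hs₁ : Function.Surjective f₁ := QuotientGroup.mk'_surjective M
  have hk₁ : f₁.ker = M := QuotientGroup.ker_mk' M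
  set O := (piGroups πᶜ).radical (G ⧸ M) with hO
  set f₂ := QuotientGroup.mk' O with hf₂
  set f := f₂.comp f₁ with hf
  have hs : Function.Surjective f := (QuotientGroup.mk'_surjective O).comp hs₁
  have hker : f.ker = O.comap f₁ := by
    rw [hf, ← MonoidHom.comap_ker, QuotientGroup.ker_mk']
  have hMker : M ≤ f.ker := by
    rw [hker]
    exact hk₁.ge.trans (f₁.ker_le_comap O)
  have hLker : L ⊓ f.ker ≤ M := by
    rcases hML.eq_or_eq (L ⊓ f.ker) inferInstance (le_inf hML.lt.le hMker) inf_le_left with h1 | h1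
    · exact h1.le
    · have h2 : L.map f₁ ≤ O := by
        rw [map_le_iff_le_comap, ← hker]
        exact inf_eq_left.1 h1
      have h3 : (p : ℕ) ∣ Nat.card (L.map f₁) := by
        rw [← relIndex_ker, hk₁]
        exact hp
      exact absurd hpπ ((piGroups_radical_mem πᶜ (G ⧸ M)).2 p (h3.trans (card_dvd_of_le h2)))
  have hMbot : M.map f = ⊥ := (Subgroup.map_eq_bot_iff M).2 hMker
  have hchief := hML.map_of_inf_ker_le hs hLker
  have hdvd := dvd_relIndex_map_of_inf_ker_le hs hMn hML.lt.le hLker hp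
  rw [hMbot] at hchief hdvd
  rw [relIndex_bot_left] at hdvd
  refine commutator_le_of_map_of_inf_ker_le hLn hML.lt.le hLker ?_
  rw [hMbot, hF.residual_map_of_surjective f hs]
  refine (residual_le_centralizer hF hS hpπ
    (h.imp_left (hF.formationProduct_piSolvableGroups_mem_of_surjective hs)) hchief hdvd
    fun U => ?_).le
  have h1 : L.map f ≤ piNorm πᶜ F ((G ⧸ M) ⧸ O) :=
    (map_mono hL).trans (hF.norm_piGroups_map_le πᶜ hs)
  have h2 := h1.trans (iInf_le _ U)
  rwa [piGroups_radical_quotient, sup_bot_eq] at h2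

theorem IsFormation.relHypercentre_eq_bot_of_piNorm_eq_bot (hF : F.IsFormation)
    (hS : F.IsSubgroupClosed) {G : Type u} [Group G] [Finite G] (h : piNorm πᶜ F G = ⊥) :
    relHypercentre π (F.residual G) = ⊥ := by
  by_contra hne
  obtain ⟨M, hMZ, hM⟩ := exists_isChiefFactor_bot inferInstance inferInstance
    (bot_lt_iff_ne_bot.2 hne)
  refine hM.lt.not_ge (le_of_le_of_eq ?_ h)
  by_cases hp : ∃ p ∈ π, (p : ℕ) ∣ (⊥ : Subgroup G).relIndex M
  · exact hF.le_norm_of_commutator_eq_bot hS _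
      (le_bot_iff.1 (isPiCentralizedBy_relHypercentre _ _ hM hMZ hp))
  · refine (le_radical (X := piGroups πᶜ) hM.normal_top ⟨inferInstance, fun p hpM hpπ => hp ⟨p, hpπ, ?_⟩⟩).trans
      (radical_le_norm _ F G)
    rwa [relIndex_bot_left]

theorem IsFormation.normSeries_le_relHypercentre (hF : F.IsFormation) (hS : F.IsSubgroupClosed)
    {G : Type u} [Group G] [Finite G]
    (h : (formationProduct (piSolvableGroups π) F).Mem G ∨ BoundaryConditionII π F) (i : ℕ) :
    (normSeries (piGroups πᶜ) F G i).1 ≤ relHypercentre π (F.residual G) := by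
  induction i with
  | zero => exact bot_le
  | succ i ih =>
    set N := (normSeries (piGroups πᶜ) F G i).1 with hN
    have hNn : N.Normal := (normSeries (piGroups πᶜ) F G i).2
    have hs := QuotientGroup.mk'_surjective N
    have hker := QuotientGroup.ker_mk' N
    have h1 := hF.piNorm_le_relHypercentre hS
      (h.imp_left (hF.formationProduct_piSolvableGroups_mem_of_surjective hs))
    rw [← hF.residual_map_of_surjective _ hs, ← relHypercentre_map hs (hker.le.trans ih)] at h1
    refine (comap_mono h1).trans (le_of_eq ?_)
    rw [comap_map_eq, hker, sup_eq_left.2 ih]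

theorem normSeries_le_succ (X F : GroupClass.{u}) (G : Type u) [Group G] (i : ℕ) :
    (normSeries X F G i).1 ≤ (normSeries X F G (i + 1)).1 := by
  have := (normSeries X F G i).2
  have h := (QuotientGroup.mk' (normSeries X F G i).1).ker_le_comap
    (X.norm F (G ⧸ (normSeries X F G i).1))
  rwa [QuotientGroup.ker_mk'] at h

/-- Where the series becomes stationary the quotient has trivial norm, hence trivial relative
hypercentre, and this contains the image of the one of `G`. -/
theorem IsFormation.relHypercentre_le_piNormInfty (hF : F.IsFormation) (hS : F.IsSubgroupClosed)
    (π : Set Nat.Primes) (G : Type u) [Group G] [Finite G] :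
    relHypercentre π (F.residual G) ≤ piNormInfty πᶜ F G := by
  obtain ⟨n, hn⟩ := WellFoundedGT.monotone_chain_condition
    (⟨fun i => (normSeries (piGroups πᶜ) F G i).1,
      monotone_nat_of_le_succ (normSeries_le_succ _ F G)⟩ : ℕ →o Subgroup G)
  have hn' : (normSeries (piGroups πᶜ) F G n).1 = (normSeries (piGroups πᶜ) F G (n + 1)).1 :=
    hn (n + 1) n.le_succ
  refine le_trans ?_ (le_iSup (fun i => (normSeries (piGroups πᶜ) F G i).1) n)
  set N := (normSeries (piGroups πᶜ) F G n).1 with hN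
  have hNn : N.Normal := (normSeries (piGroups πᶜ) F G n).2
  have hs := QuotientGroup.mk'_surjective N
  have hker := QuotientGroup.ker_mk' N
  have hn'' : N = (piNorm πᶜ F (G ⧸ N)).comap (QuotientGroup.mk' N) := hn'
  have hbot : piNorm πᶜ F (G ⧸ N) = ⊥ := by
    rw [← map_comap_eq_self_of_surjective hs (piNorm πᶜ F (G ⧸ N)), Subgroup.map_eq_bot_iff, hker]
    exact hn''.ge
  have h1 := relHypercentre_map_le (π := π) (R := F.residual G) hs
  rw [hF.residual_map_of_surjective _ hs, hF.relHypercentre_eq_bot_of_piNorm_eq_bot hS hbot,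
    le_bot_iff, Subgroup.map_eq_bot_iff, hker] at h1
  exact h1

/-! ### Chief factors avoiding the residual -/

/-- With `E = M G^F`, the factor `L/M` embeds in `G/E ∈ F` and `E` acts trivially on it. So `(L/M) ⋊
(G/E)` lies in `F` and maps onto the semidirect product in question. -/
theorem IsFormation.isCentralFactor_of_inf_residual_le (hF : F.IsFormation) {G : Type u} [Group G]
    [Finite G] {M L : Subgroup G} [hM : M.Normal] [hL : L.Normal] (hML : M ≤ L)
    (h : L ⊓ F.residual G ≤ M) : F.IsCentralFactor M L := by
  set E := M ⊔ F.residual G with hE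
  have hLE : L ⊓ E ≤ M := by
    intro x hx
    obtain ⟨hxL, hxE⟩ := mem_inf.1 hx
    obtain ⟨m, hm, r, hr, rfl⟩ := mem_sup_of_normal_right.1 hxE
    exact mul_mem hm (h (mem_inf.2 ⟨(mul_mem_cancel_left (hML hm)).1 hxL, hr⟩))
  have hEker : E ≤ (factorAction M L).ker := by
    rw [le_ker_factorAction_iff]
    exact (commutator_le_inf L E).trans hLE
  have hQ : F.Mem (G ⧸ E) := hF.mem_quotient_of_residual_le E le_sup_right
  have hX : F.Mem (SemidirectProduct (factor M L) (G ⧸ E)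
      (QuotientGroup.lift E (factorAction M L) hEker)) := by
    refine hF.mem_semidirectProduct
      (ι := (QuotientGroup.map M E (MonoidHom.id G) le_sup_left).comp (factor M L).subtype)
      ?_ ?_ hQ
    · rw [injective_iff_map_eq_one]
      rintro ⟨_, l, hl, rfl⟩ h1
      exact Subtype.ext ((QuotientGroup.eq_one_iff l).2
        (hLE (mem_inf.2 ⟨hl, (QuotientGroup.eq_one_iff l).1 h1⟩)))
    · rintro q ⟨_, l, hl, rfl⟩
      obtain ⟨g, rfl⟩ := QuotientGroup.mk_surjective q
      rfl
  refine hF.of_surjective (SemidirectProduct.map (MonoidHom.id _)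
    (QuotientGroup.map E (factorAction M L).ker (MonoidHom.id G) hEker) ?_) ?_ hX
  · intro q
    obtain ⟨g, rfl⟩ := QuotientGroup.mk_surjective q
    rfl
  · rintro ⟨a, q⟩
    obtain ⟨g, rfl⟩ := QuotientGroup.mk_surjective q
    exact ⟨⟨a, (g : G ⧸ E)⟩, rfl⟩

theorem hypercentre_le_hypercentre_formationProduct (π : Set Nat.Primes) (F : GroupClass.{u})
    (G : Type u) [Group G] :
    hypercentre π F G ≤ hypercentre π (formationProduct nilpotentGroups F) G := by
  refine sSup_le_sSup ?_
  rintro N ⟨hN, h⟩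
  refine ⟨hN, fun K L hKL hLN hp => ?_⟩
  have h1 := h K L hKL hLN hp
  refine ⟨F.finite h1, ?_⟩
  rw [residual_eq_bot_of_mem h1]
  exact ⟨inferInstance, inferInstance⟩

end GroupClass

theorem corollary3p4 (π : Set Nat.Primes) (F : GroupClass.{u}) (hF : F.IsFormation)
    (hS : F.IsSubgroupClosed) (G : Type u) [Group G] [Finite G]
    (h : (GroupClass.formationProduct (GroupClass.piSolvableGroups π) F).Mem G ∨
      GroupClass.BoundaryConditionII π F) :
    ∃ _ : (GroupClass.residualHypercentre π F G).Normal,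
      GroupClass.residualHypercentre π F G ≤ GroupClass.piNormInfty πᶜ F G ∧
      GroupClass.residualHypercentre π F G ≤ GroupClass.hypercentre π
        (GroupClass.formationProduct GroupClass.nilpotentGroups F) G ∧
      factor (GroupClass.residualHypercentre π F G) (GroupClass.piNormInfty πᶜ F G) =
        GroupClass.piNorm πᶜ F (G ⧸ GroupClass.residualHypercentre π F G) ∧
      GroupClass.piNorm πᶜ F (G ⧸ GroupClass.residualHypercentre π F G) =
        factor (GroupClass.residualHypercentre π F G) (GroupClass.hypercentre π
          (GroupClass.formationProduct GroupClass.nilpotentGroups F) G) ∧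
      (F.IsSaturated →
        factor (GroupClass.residualHypercentre π F G) (GroupClass.hypercentre π
            (GroupClass.formationProduct GroupClass.nilpotentGroups F) G) =
          GroupClass.hypercentre π F (G ⧸ GroupClass.residualHypercentre π F G)) := by
  have hZ := hF.hypercentre_formationProduct_eq π G
  have hinfty : GroupClass.piNormInfty πᶜ F G = relHypercentre π (F.residual G) :=
    le_antisymm (iSup_le (hF.normSeries_le_relHypercentre hS h))
      (hF.relHypercentre_le_piNormInfty hS π G)
  have hK := GroupClass.residualHypercentre_eq π F G
  rw [hinfty, hZ]
  set K := GroupClass.residualHypercentre π F G with hKdef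
  set Z := relHypercentre π (F.residual G) with hZdef
  have hKn : K.Normal := by rw [hK]; infer_instance
  have hKZ : K ≤ Z := hK.le.trans inf_le_left
  have hs := QuotientGroup.mk'_surjective K
  have hker := QuotientGroup.ker_mk' K
  have hR := hF.residual_map_of_surjective _ hs
  have hZmap : factor K Z = relHypercentre π (F.residual (G ⧸ K)) := by
    rw [← hR]
    exact relHypercentre_map hs (hker.le.trans hKZ)
  -- Both `Z` and `G^F` are normal, so their commutator lies in `Z ∩ G^F = K`.
  have hcomm : ⁅factor K Z, F.residual (G ⧸ K)⁆ = ⊥ := by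
    rw [← hR, ← map_commutator, Subgroup.map_eq_bot_iff, hker, hK]
    exact commutator_le_inf Z _
  have hinf : factor K Z ⊓ F.residual (G ⧸ K) = ⊥ := by
    rw [← hR, eq_bot_iff]
    rintro _ ⟨⟨z, hz, rfl⟩, r, hr, hrz⟩
    have h1 : r⁻¹ * z ∈ K := QuotientGroup.eq.1 hrz
    have h2 : z ∈ F.residual G := by
      simpa using mul_mem hr (hK.le.trans inf_le_right h1)
    exact (QuotientGroup.eq_one_iff z).2 (hK ▸ mem_inf.2 ⟨hz, h2⟩)
  have hnorm : GroupClass.piNorm πᶜ F (G ⧸ K) = factor K Z := by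
    refine le_antisymm ?_ (hF.le_norm_of_commutator_eq_bot hS _ hcomm)
    rw [hZmap]
    exact hF.piNorm_le_relHypercentre hS
      (h.imp_left (hF.formationProduct_piSolvableGroups_mem_of_surjective hs))
  refine ⟨hKn, hKZ, hKZ, hnorm.symm, hnorm, fun _ => le_antisymm ?_ ?_⟩
  · refine le_sSup ⟨relHypercentre_normal.map _ hs, fun M L hML hLZ _ => ?_⟩
    have := hML.normal_bot
    have := hML.normal_top
    refine hF.isCentralFactor_of_inf_residual_le hML.lt.le ?_
    exact (inf_le_inf_right _ hLZ).trans (hinf.le.trans bot_le)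
  · rw [hZmap, ← hF.hypercentre_formationProduct_eq]
    exact GroupClass.hypercentre_le_hypercentre_formationProduct π F _
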